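/- Let $n,d\ge 1$, $R>1$, let $W,V\in\mathbb R^{d\times d}$ and $B\in\mathbb R^{n\times d}$ with $\|W\|_F\le R$, $\|V\|_F\le R$ and $|b_{i,j}|\le R$ for all $i,j$, and for $X\in\mathbb R^{d\times n}$ let $$L_\gamma(X)=\|D(X)^{-1}\exp(X^\top WX)X^\top V-B\|_F^2+\gamma\,\|\mathrm{vec}(X)\|_2^2,\qquad D(X)=\mathrm{diag}(\exp(X^\top WX)\mathbf 1_n),$$ with $\exp$ applied entrywise. For $\epsilon_0>0$, an $\epsilon_0$-approximate Newton step leads from $X$ to the matrix $Y$ with $\mathrm{vec}(Y)=\mathrm{vec}(X)-\widetilde H^{-1}\nabla L_\gamma(X)$, where $\widetilde H$ is some symmetric matrix with $(1-\epsilon_0)\nabla^2L_\gamma(X)\preceq\widetilde H\preceq(1+\epsilon_0)\nabla^2L_\gamma(X)$. There are absolute constants $C_\gamma,C_M,C_T>0$ such that the following holds for every $\epsilon_0\in(0,0.1]$. There are a program for a real random access machine (exact real arithmetic, $\exp$ and comparisons at unit cost) and numbers $C,k\in\mathbb N$, depending only on $\epsilon_0$, such that for all $n,d,R,W,V,B$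 as above and all $\gamma\ge C_\gamma\,nd\,R^8$: 1. $\nabla^2L_\gamma(X)$ is positive definite for all $X$ with $\|X\|_F\le R$. 2. Let $X^*$ be a minimizer of $L_\gamma$ over $\mathbb R^{d\times n}$, let $l>0$ satisfy $\nabla^2L_\gamma(X^*)\succeq l\cdot I_{nd}$, and let $X_0$ satisfy $\|X_0\|_F\le R$ and $M\|X_0-X^*\|_F\le 0.1\,l$ with $M=C_M\,n^3d^3R^{10}$. Then: (a) For all $\epsilon,\delta\in(0,0.1)$ and every natural number $T\ge C_T\log(\|X_0-X^*\|_F/\epsilon)$ (no condition on $T$ if $X_0=X^*$): if $X_0,X_1,\dots$ is a random sequence of matrices starting at $X_0$ whose first $T$ steps are, with probability at least $1-\delta$, all $\epsilon_0$-approximate Newton steps, then $\widetilde X=X_T$ satisfies $\|\widetilde X-X^*\|_F\le\epsilon$ with probability at least $1-\delta$. (b) Let $X_0,X_1,\dots$ be the sequence in which $X_{t+1}$ is the output of the program on the input $(n,d,W,V,B,\gamma,X_t)$. Each of its steps is an $\epsilon_0$-approximate Newton step and takes at most $C(nd)^k$ machine steps, and for every $\epsilon\in(0,0.1)$ and every natural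 number $T\ge C_T\log(\|X_0-X^*\|_F/\epsilon)$ (no condition on $T$ if $X_0=X^*$), $\widetilde X=X_T$ satisfies $\|\widetilde X-X^*\|_F\le\epsilon$. -/

import Mathlib

namespace AttentionInversion

/-! ### The regularized inversion loss -/

/-- The Frobenius norm of a real matrix. -/
noncomputable def frobNorm {p q : ℕ} (A : Matrix (Fin p) (Fin q) ℝ) : ℝ :=
  Real.sqrt (∑ i, ∑ j, A i j ^ 2)

/-- The matrix `exp(Xᵀ W X)`, where the exponential is applied entry by entry. -/
noncomputable def expScores {n d : ℕ} (W : Matrix (Fin d) (Fin d) ℝ)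
    (X : Matrix (Fin d) (Fin n) ℝ) : Matrix (Fin n) (Fin n) ℝ :=
  (X.transpose * W * X).map Real.exp

/-- `D(X) = diag(exp(Xᵀ W X) 1)`. -/
noncomputable def normalizer {n d : ℕ} (W : Matrix (Fin d) (Fin d) ℝ)
    (X : Matrix (Fin d) (Fin n) ℝ) : Matrix (Fin n) (Fin n) ℝ :=
  Matrix.diagonal ((expScores W X).mulVec 1)

/-- `‖D(X)⁻¹ exp(Xᵀ W X) Xᵀ V - B‖_F² + γ ‖vec X‖₂²`. -/
noncomputable def regLoss {n d : ℕ} (W V : Matrix (Fin d) (Fin d) ℝ)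
    (B : Matrix (Fin n) (Fin d) ℝ) (γ : ℝ) (X : Matrix (Fin d) (Fin n) ℝ) : ℝ :=
  frobNorm ((normalizer W X)⁻¹ * expScores W X * X.transpose * V - B) ^ 2
    + γ * ∑ i, ∑ j, X i j ^ 2

/-! ### Gradient, Hessian and Newton steps for functions of a matrix -/

/-- The partial derivative `∂f/∂X_{ij}`, again as a function of the matrix `X`. -/
noncomputable def partialDeriv {n d : ℕ} (f : Matrix (Fin d) (Fin n) ℝ → ℝ)
    (p : Fin d × Fin n) (X : Matrix (Fin d) (Fin n) ℝ) : ℝ :=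
  lineDeriv ℝ f X (Matrix.single p.1 p.2 1)

/-- The gradient of `f` at `X`, as a vector of length `dn`. -/
noncomputable def gradVec {n d : ℕ} (f : Matrix (Fin d) (Fin n) ℝ → ℝ)
    (X : Matrix (Fin d) (Fin n) ℝ) : Fin d × Fin n → ℝ :=
  fun p => partialDeriv f p X

/-- The Hessian of `f` at `X`, as a `dn × dn` matrix. -/
noncomputable def hessian {n d : ℕ} (f : Matrix (Fin d) (Fin n) ℝ → ℝ)
    (X : Matrix (Fin d) (Fin n) ℝ) : Matrix (Fin d × Fin n) (Fin d × Fin n) ℝ :=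
  Matrix.of fun p q => partialDeriv (partialDeriv f q) p X

/-- `Y` is obtained from `X` by one approximate Newton step for `f`:
`vec Y = vec X - H⁻¹ ∇f(X)` for some symmetric `H` with
`(1 - ε₀) ∇²f(X) ⪯ H ⪯ (1 + ε₀) ∇²f(X)`. -/
def IsApproxNewtonStep {n d : ℕ} (ε₀ : ℝ) (f : Matrix (Fin d) (Fin n) ℝ → ℝ)
    (X Y : Matrix (Fin d) (Fin n) ℝ) : Prop :=
  ∃ H : Matrix (Fin d × Fin n) (Fin d × Fin n) ℝ,
    H.IsSymm ∧
    (H - (1 - ε₀) • hessian f X).PosSemidef ∧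
    ((1 + ε₀) • hessian f X - H).PosSemidef ∧
    ∀ i j, Y i j = X i j - (H⁻¹.mulVec (gradVec f X)) (i, j)

/-! ### A real random access machine with a step count

A program works on integer registers and on arrays of real numbers of arbitrary rank. It has
exact real arithmetic, the exponential function, comparisons, and loops. Every evaluation of a
node of an expression, every assignment, every test and every loop iteration costs one step. -/

/-- A state: the contents of the integer registers, and of the cells of the real arrays. -/
structure State where
  reg : ℕ → ℕ
  mem : ℕ → List ℕ → ℝ

/-- Integer expressions; subtraction is truncated at `0`. -/
inductive NatExpr where
  | lit (k : ℕ)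
  | var (x : ℕ)
  | add (e₁ e₂ : NatExpr)
  | sub (e₁ e₂ : NatExpr)

def NatExpr.eval (s : State) : NatExpr → ℕ
  | .lit k => k
  | .var x => s.reg x
  | .add e₁ e₂ => e₁.eval s + e₂.eval s
  | .sub e₁ e₂ => e₁.eval s - e₂.eval s

def NatExpr.cost : NatExpr → ℕ
  | .lit _ => 1
  | .var _ => 1
  | .add e₁ e₂ => e₁.cost + e₂.cost + 1
  | .sub e₁ e₂ => e₁.cost + e₂.cost + 1

/-- Real expressions: rational constants, array cells, the four operations (`x / 0` evaluates
to `0`), and the exponential function. -/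
inductive RealExpr where
  | lit (c : ℚ)
  | cell (a : ℕ) (idx : List NatExpr)
  | add (e₁ e₂ : RealExpr)
  | sub (e₁ e₂ : RealExpr)
  | mul (e₁ e₂ : RealExpr)
  | div (e₁ e₂ : RealExpr)
  | exp (e : RealExpr)

noncomputable def RealExpr.eval (s : State) : RealExpr → ℝ
  | .lit c => (c : ℝ)
  | .cell a idx => s.mem a (idx.map (NatExpr.eval s))
  | .add e₁ e₂ => e₁.eval s + e₂.eval s
  | .sub e₁ e₂ => e₁.eval s - e₂.eval s
  | .mul e₁ e₂ => e₁.eval s * e₂.eval s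
  | .div e₁ e₂ => e₁.eval s / e₂.eval s
  | .exp e => Real.exp (e.eval s)

def RealExpr.cost : RealExpr → ℕ
  | .lit _ => 1
  | .cell _ idx => (idx.map NatExpr.cost).sum + 1
  | .add e₁ e₂ => e₁.cost + e₂.cost + 1
  | .sub e₁ e₂ => e₁.cost + e₂.cost + 1
  | .mul e₁ e₂ => e₁.cost + e₂.cost + 1
  | .div e₁ e₂ => e₁.cost + e₂.cost + 1
  | .exp e => e.cost + 1

/-- Programs. `loop x e c` evaluates `e` to a number `N` and then runs `c` for
`x = 0, 1, …, N - 1`. -/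
inductive Program where
  | skip
  | setReg (x : ℕ) (e : NatExpr)
  | setCell (a : ℕ) (idx : List NatExpr) (e : RealExpr)
  | seq (c₁ c₂ : Program)
  | ifNatLe (e₁ e₂ : NatExpr) (c₁ c₂ : Program)
  | ifRealLe (e₁ e₂ : RealExpr) (c₁ c₂ : Program)
  | loop (x : ℕ) (e : NatExpr) (c : Program)

def State.setReg (s : State) (x v : ℕ) : State :=
  { s with reg := Function.update s.reg x v }

def State.setCell (s : State) (a : ℕ) (idx : List ℕ) (v : ℝ) : State :=
  { s with mem := Function.update s.mem a (Function.update (s.mem a) idx v) }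

/-- Running a program: the final state and the number of steps. -/
noncomputable def Program.run : Program → State → State × ℕ
  | .skip, s => (s, 1)
  | .setReg x e, s => (s.setReg x (e.eval s), e.cost + 1)
  | .setCell a idx e, s =>
      (s.setCell a (idx.map (NatExpr.eval s)) (e.eval s),
        (idx.map NatExpr.cost).sum + e.cost + 1)
  | .seq c₁ c₂, s =>
      ((c₂.run (c₁.run s).1).1, (c₁.run s).2 + (c₂.run (c₁.run s).1).2)
  | .ifNatLe e₁ e₂ c₁ c₂, s =>
      let r := if e₁.eval s ≤ e₂.eval s then c₁.run s else c₂.run s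
      (r.1, e₁.cost + e₂.cost + 1 + r.2)
  | .ifRealLe e₁ e₂ c₁ c₂, s =>
      let r := if e₁.eval s ≤ e₂.eval s then c₁.run s else c₂.run s
      (r.1, e₁.cost + e₂.cost + 1 + r.2)
  | .loop x e c, s =>
      (List.range (e.eval s)).foldl
        (fun r i => ((c.run (r.1.setReg x i)).1, r.2 + (c.run (r.1.setReg x i)).2 + 1))
        (s, e.cost + 1)

/-- A matrix as an array of rank two, filled up with zeros. -/
noncomputable def toArray {p q : ℕ} (A : Matrix (Fin p) (Fin q) ℝ) : List ℕ → ℝ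
  | [i, j] => if h : i < p ∧ j < q then A ⟨i, h.1⟩ ⟨j, h.2⟩ else 0
  | _ => 0

/-- The input of an iteration: `n` and `d` in the registers `0` and `1`, the matrices `W`, `V`,
`B`, `X` in the arrays `0`, `1`, `2`, `4`, the number `γ` in the cell of the rank-zero array `3`,
and zeros elsewhere. -/
noncomputable def inputState {n d : ℕ} (W V : Matrix (Fin d) (Fin d) ℝ)
    (B : Matrix (Fin n) (Fin d) ℝ) (γ : ℝ) (X : Matrix (Fin d) (Fin n) ℝ) : State where
  reg x := match x with
    | 0 => n
    | 1 => d
    | _ => 0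
  mem a := match a with
    | 0 => toArray W
    | 1 => toArray V
    | 2 => toArray B
    | 3 => fun idx => if idx = [] then γ else 0
    | 4 => toArray X
    | _ => fun _ => 0

/-- The output of one run of the program: the matrix in the array `4` of the final state. -/
noncomputable def Program.output {n d : ℕ} (c : Program) (W V : Matrix (Fin d) (Fin d) ℝ)
    (B : Matrix (Fin n) (Fin d) ℝ) (γ : ℝ) (X : Matrix (Fin d) (Fin n) ℝ) :
    Matrix (Fin d) (Fin n) ℝ :=
  Matrix.of fun i j => (c.run (inputState W V B γ X)).1.mem 4 [(i : ℕ), (j : ℕ)]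

/-- The number of steps of one run of the program. -/
noncomputable def Program.steps {n d : ℕ} (c : Program) (W V : Matrix (Fin d) (Fin d) ℝ)
    (B : Matrix (Fin n) (Fin d) ℝ) (γ : ℝ) (X : Matrix (Fin d) (Fin n) ℝ) : ℕ :=
  (c.run (inputState W V B γ X)).2

/-- The iterates of the method whose iteration is one run of the program. -/
noncomputable def Program.iterate {n d : ℕ} (c : Program) (W V : Matrix (Fin d) (Fin d) ℝ)
    (B : Matrix (Fin n) (Fin d) ℝ) (γ : ℝ) (X₀ : Matrix (Fin d) (Fin n) ℝ) (t : ℕ) :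
    Matrix (Fin d) (Fin n) ℝ :=
  (c.output W V B γ)^[t] X₀

end AttentionInversion

open AttentionInversion

/-! The regularizer dominates. On the ball of radius `2 * R` the second derivative of the fitting
term is a bilinear form of norm at most `2000 * n * d * R ^ 8`, because softmax weights are
nonnegative and sum to one, so averages with them cost no factor `n` (`abs_fitDD_le`). With `γ ≥
100000 * n * d * R ^ 8` this is at most `0.02 * γ`, so the Hessian is `2γ` times the identity up to
an error of operator norm `0.02 * γ`. Positive definiteness is immediate.

Comparison with `X = 0` shows that a minimizer is small (`frobNorm_minimizer_le`), so the segment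
from it to the starting point stays in the ball. By the mean value theorem the gradient at `X` is
`2γ (X - X*)` up to `0.02 * γ * ‖X - X*‖`, while the approximate Hessian `H` is within `0.24 * γ` of
`2γ` and at least `1.78 * γ`. One step therefore multiplies the distance to the minimizer by at most
`0.26 / 1.78 < 1/2` (`norm_step_le`). The error never grows, the iterates stay in the ball, and `T ≥
2 log (‖X₀ - X*‖ / ε)` steps suffice. In the random setting this holds outcome by outcome.

The program takes an exact Newton step, which is an approximate one for every `ε₀ > 0`. It tabulates
the explicit derivative formulas (`derivativeDefs_values`) and solves the linear system by
Gauss–Jordan elimination without pivot search, which never divides by zero since the Hessian is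
positive definite (`Eliminated.pivot_ne_zero`). All its loops range over `n` or `d`, which makes the
running time polynomial (`Program.Bounded.exists_steps_le`). -/

namespace AttentionInversion

/-! ### Running time of programs whose loops range over the two dimensions -/

/-- All loops of the program range over the number in register `0` or in register `1`, and the
program never writes to these two registers. -/
def Program.Bounded : Program → Prop
  | .skip => True
  | .setReg x _ => 2 ≤ x
  | .setCell _ _ _ => True
  | .seq c₁ c₂ => c₁.Bounded ∧ c₂.Bounded
  | .ifNatLe _ _ c₁ c₂ => c₁.Bounded ∧ c₂.Bounded
  | .ifRealLe _ _ c₁ c₂ => c₁.Bounded ∧ c₂.Bounded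
  | .loop x e c => 2 ≤ x ∧ (e = .var 0 ∨ e = .var 1) ∧ c.Bounded

theorem State.setReg_reg_of_ne (s : State) {x y : ℕ} (v : ℕ) (h : y ≠ x) :
    (s.setReg x v).reg y = s.reg y := by
  simp [State.setReg, Function.update_of_ne h]

theorem Program.loop_rule (P : ℕ → State → Prop) (x : ℕ) (e : NatExpr) (c : Program) (s : State)
    (h0 : P 0 s)
    (hstep : ∀ i < e.eval s, ∀ s', P i s' → P (i + 1) (c.run (s'.setReg x i)).1) :
    P (e.eval s) ((Program.loop x e c).run s).1 := by
  simp only [Program.run]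
  generalize e.eval s = N at hstep
  generalize e.cost + 1 = k
  induction N with
  | zero => simpa using h0
  | succ N ih =>
    rw [List.range_succ, List.foldl_append]
    exact hstep N (Nat.lt_succ_self N) _ (ih fun i hi => hstep i (hi.trans (Nat.lt_succ_self N)))

theorem Program.loop_cost_le (Q : State → Prop) (x : ℕ) (e : NatExpr) (c : Program) (s : State)
    (K : ℕ) (h0 : Q s)
    (hstep : ∀ i s', Q s' → Q (c.run (s'.setReg x i)).1 ∧ (c.run (s'.setReg x i)).2 ≤ K) :
    ((Program.loop x e c).run s).2 ≤ e.cost + 1 + e.eval s * (K + 1) := by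
  simp only [Program.run]
  generalize e.eval s = N
  generalize e.cost + 1 = k
  suffices h : ∀ N, let r := (List.range N).foldl (fun (r : State × ℕ) i =>
      ((c.run (r.1.setReg x i)).1, r.2 + (c.run (r.1.setReg x i)).2 + 1)) (s, k)
      Q r.1 ∧ r.2 ≤ k + N * (K + 1) from (h N).2
  intro N
  induction N with
  | zero => simpa using h0
  | succ N ih =>
    simp only [List.range_succ, List.foldl_append, List.foldl_cons, List.foldl_nil] at ih ⊢
    obtain ⟨h1, h2⟩ := hstep N _ ih.1
    refine ⟨h1, ?_⟩
    have := ih.2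
    rw [Nat.succ_mul]
    omega

theorem Program.Bounded.run_reg {c : Program} (hc : c.Bounded) (s : State) :
    (c.run s).1.reg 0 = s.reg 0 ∧ (c.run s).1.reg 1 = s.reg 1 := by
  induction c generalizing s with
  | skip => simp [Program.run]
  | setReg x e =>
    have hx : 2 ≤ x := hc
    exact ⟨s.setReg_reg_of_ne _ (by omega), s.setReg_reg_of_ne _ (by omega)⟩
  | setCell a idx e => simp [Program.run, State.setCell]
  | seq c₁ c₂ ih₁ ih₂ =>
    simp only [Program.run, (ih₂ hc.2 _).1, (ih₂ hc.2 _).2]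
    exact ih₁ hc.1 s
  | ifNatLe e₁ e₂ c₁ c₂ ih₁ ih₂ =>
    simp only [Program.run]
    split
    exacts [ih₁ hc.1 s, ih₂ hc.2 s]
  | ifRealLe e₁ e₂ c₁ c₂ ih₁ ih₂ =>
    simp only [Program.run]
    split
    exacts [ih₁ hc.1 s, ih₂ hc.2 s]
  | loop x e c ih =>
    obtain ⟨hx, -, hc⟩ := hc
    refine Program.loop_rule (fun _ s' => s'.reg 0 = s.reg 0 ∧ s'.reg 1 = s.reg 1) x e c s
      ⟨rfl, rfl⟩ fun i _ s' h => ?_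
    have := ih hc (s'.setReg x i)
    rwa [s'.setReg_reg_of_ne _ (by omega), s'.setReg_reg_of_ne _ (by omega), h.1, h.2] at this

/-- The loop bounds sit in registers that the program never overwrites, so every loop has at most
`m` rounds, and each level of nesting raises the degree by one. -/
theorem Program.Bounded.exists_steps_le {c : Program} (hc : c.Bounded) :
    ∃ C k : ℕ, ∀ (s : State) (m : ℕ), 1 ≤ m → s.reg 0 ≤ m → s.reg 1 ≤ m →
      (c.run s).2 ≤ C * m ^ k := by
  have key : ∀ C₁ k₁ C₂ k₂ a b c m : ℕ, 1 ≤ m → a ≤ C₁ * m ^ k₁ → b ≤ C₂ * m ^ k₂ →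
      c + a + b ≤ (c + C₁ + C₂) * m ^ (k₁ + k₂) := by
    intro C₁ k₁ C₂ k₂ a b c m hm ha hb
    have h1 : m ^ k₁ ≤ m ^ (k₁ + k₂) := Nat.pow_le_pow_right hm (by omega)
    have h2 : m ^ k₂ ≤ m ^ (k₁ + k₂) := Nat.pow_le_pow_right hm (by omega)
    have h3 : 1 ≤ m ^ (k₁ + k₂) := Nat.one_le_pow _ _ hm
    nlinarith [Nat.mul_le_mul_left C₁ h1, Nat.mul_le_mul_left C₂ h2, Nat.mul_le_mul_left c h3]
  induction c with
  | skip => exact ⟨1, 0, fun s m _ _ _ => by simp [Program.run]⟩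
  | setReg x e => exact ⟨e.cost + 1, 0, fun s m _ _ _ => by simp [Program.run]⟩
  | setCell a idx e =>
    exact ⟨(idx.map NatExpr.cost).sum + e.cost + 1, 0, fun s m _ _ _ => by simp [Program.run]⟩
  | seq c₁ c₂ ih₁ ih₂ =>
    obtain ⟨C₁, k₁, h₁⟩ := ih₁ hc.1
    obtain ⟨C₂, k₂, h₂⟩ := ih₂ hc.2
    refine ⟨0 + C₁ + C₂, k₁ + k₂, fun s m hm h0 h1 => ?_⟩
    have hr := hc.1.run_reg s
    have := key C₁ k₁ C₂ k₂ _ _ 0 m hm (h₁ s m hm h0 h1)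
      (h₂ (c₁.run s).1 m hm (hr.1 ▸ h0) (hr.2 ▸ h1))
    simpa [Program.run] using this
  | ifNatLe e₁ e₂ c₁ c₂ ih₁ ih₂ =>
    obtain ⟨C₁, k₁, h₁⟩ := ih₁ hc.1
    obtain ⟨C₂, k₂, h₂⟩ := ih₂ hc.2
    refine ⟨e₁.cost + e₂.cost + 1 + C₁ + C₂, k₁ + k₂, fun s m hm h0 h1 => ?_⟩
    have := key C₁ k₁ C₂ k₂ _ _ (e₁.cost + e₂.cost + 1) m hm (h₁ s m hm h0 h1) (h₂ s m hm h0 h1)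
    simp only [Program.run]
    split <;> omega
  | ifRealLe e₁ e₂ c₁ c₂ ih₁ ih₂ =>
    obtain ⟨C₁, k₁, h₁⟩ := ih₁ hc.1
    obtain ⟨C₂, k₂, h₂⟩ := ih₂ hc.2
    refine ⟨e₁.cost + e₂.cost + 1 + C₁ + C₂, k₁ + k₂, fun s m hm h0 h1 => ?_⟩
    have := key C₁ k₁ C₂ k₂ _ _ (e₁.cost + e₂.cost + 1) m hm (h₁ s m hm h0 h1) (h₂ s m hm h0 h1)
    simp only [Program.run]
    split <;> omega
  | loop x e c ih =>
    obtain ⟨hx, he, hc⟩ := hc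
    obtain ⟨C, k, h⟩ := ih hc
    -- The loop costs at most `2 + m * (C * m ^ k + 1)`: two steps for the loop bound and one extra
    -- per round. Three further multiples of `m ^ (k + 1)` absorb `2 + m`.
    refine ⟨C + 3, k + 1, fun s m hm h0 h1 => ?_⟩
    have hcost := Program.loop_cost_le (fun s' => s'.reg 0 = s.reg 0 ∧ s'.reg 1 = s.reg 1) x e c s
      (C * m ^ k) ⟨rfl, rfl⟩ fun i s' hs' => by
        have r0 := s'.setReg_reg_of_ne i (show 0 ≠ x by omega)
        have r1 := s'.setReg_reg_of_ne i (show 1 ≠ x by omega)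
        have hr := hc.run_reg (s'.setReg x i)
        rw [r0, r1, hs'.1, hs'.2] at hr
        exact ⟨hr, h _ m hm (by rw [r0, hs'.1]; exact h0) (by rw [r1, hs'.2]; exact h1)⟩
    have hle : e.eval s ≤ m := by rcases he with rfl | rfl <;> assumption
    have hec : e.cost = 1 := by rcases he with rfl | rfl <;> rfl
    have h4 : 1 ≤ m ^ k := Nat.one_le_pow _ _ hm
    have h5 := Nat.mul_le_mul_right (C * m ^ k + 1) hle
    rw [hec] at hcost
    calc _ ≤ _ := hcost
      _ ≤ 2 + m * (C * m ^ k + 1) := by omega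
      _ ≤ (C + 3) * m ^ (k + 1) := by
        rw [pow_succ]
        nlinarith [Nat.mul_le_mul h4 hm]

/-! ### Dependence of expressions on the state -/

def NatExpr.bound : NatExpr → ℕ
  | .lit _ => 0
  | .var x => x + 1
  | .add e₁ e₂ => max e₁.bound e₂.bound
  | .sub e₁ e₂ => max e₁.bound e₂.bound

/-- All registers that occur in the expression are below this number. -/
def RealExpr.bound : RealExpr → ℕ
  | .lit _ => 0
  | .cell _ idx => (idx.map NatExpr.bound).foldr max 0
  | .add e₁ e₂ => max e₁.bound e₂.bound
  | .sub e₁ e₂ => max e₁.bound e₂.bound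
  | .mul e₁ e₂ => max e₁.bound e₂.bound
  | .div e₁ e₂ => max e₁.bound e₂.bound
  | .exp e => e.bound

/-- The arrays that an expression reads. -/
def RealExpr.arrays : RealExpr → List ℕ
  | .lit _ => []
  | .cell a _ => [a]
  | .add e₁ e₂ => e₁.arrays ++ e₂.arrays
  | .sub e₁ e₂ => e₁.arrays ++ e₂.arrays
  | .mul e₁ e₂ => e₁.arrays ++ e₂.arrays
  | .div e₁ e₂ => e₁.arrays ++ e₂.arrays
  | .exp e => e.arrays

theorem NatExpr.eval_congr {s s' : State} (e : NatExpr)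
    (h : ∀ y < e.bound, s.reg y = s'.reg y) : e.eval s = e.eval s' := by
  induction e with
  | lit k => rfl
  | var x => exact h x (Nat.lt_succ_self x)
  | add e₁ e₂ ih₁ ih₂ =>
    simp only [NatExpr.bound, lt_max_iff] at h
    simp only [NatExpr.eval, ih₁ fun y hy => h y (.inl hy), ih₂ fun y hy => h y (.inr hy)]
  | sub e₁ e₂ ih₁ ih₂ =>
    simp only [NatExpr.bound, lt_max_iff] at h
    simp only [NatExpr.eval, ih₁ fun y hy => h y (.inl hy), ih₂ fun y hy => h y (.inr hy)]

theorem NatExpr.map_eval_congr {s s' : State} (idx : List NatExpr)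
    (h : ∀ y < (idx.map NatExpr.bound).foldr max 0, s.reg y = s'.reg y) :
    idx.map (NatExpr.eval s) = idx.map (NatExpr.eval s') := by
  induction idx with
  | nil => rfl
  | cons e idx ih =>
    simp only [List.map_cons, List.foldr_cons, lt_max_iff] at h ⊢
    rw [ih fun y hy => h y (.inr hy), e.eval_congr fun y hy => h y (.inl hy)]

theorem RealExpr.eval_congr {s s' : State} (e : RealExpr)
    (h : ∀ y < e.bound, s.reg y = s'.reg y) (hm : ∀ b ∈ e.arrays, s.mem b = s'.mem b) :
    e.eval s = e.eval s' := by
  induction e with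
  | lit c => rfl
  | cell a idx =>
    simp only [RealExpr.eval, hm a (by simp [RealExpr.arrays]), NatExpr.map_eval_congr idx h]
  | exp e ih => simp only [RealExpr.eval, ih h hm]
  | add e₁ e₂ ih₁ ih₂ | sub e₁ e₂ ih₁ ih₂ | mul e₁ e₂ ih₁ ih₂ | div e₁ e₂ ih₁ ih₂ =>
    simp only [RealExpr.bound, lt_max_iff] at h
    simp only [RealExpr.arrays, List.mem_append] at hm
    simp only [RealExpr.eval,
      ih₁ (fun y hy => h y (.inl hy)) fun b hb => hm b (.inl hb),
      ih₂ (fun y hy => h y (.inr hy)) fun b hb => hm b (.inr hb)]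

/-! ### Nested loops that accumulate a sum -/

/-- Nested loops with the loop registers `x, x + 1, …` over the numbers in the registers `bs`. -/
def nest (x : ℕ) : List ℕ → Program → Program
  | [], c => c
  | b :: bs, c => .loop x (.var b) (nest (x + 1) bs c)

/-- The sum of the values of `F` over the register contents met by `nest x bs`. -/
def nestSum (ρ : ℕ → ℕ) (x : ℕ) : List ℕ → ((ℕ → ℕ) → ℝ) → ℝ
  | [], F => F ρ
  | b :: bs, F => ∑ i ∈ Finset.range (ρ b), nestSum (Function.update ρ x i) (x + 1) bs F

/-- `a[idx] += e`. -/
def increment (a : ℕ) (idx : List NatExpr) (e : RealExpr) : Program :=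
  .setCell a idx (.add (.cell a idx) e)

theorem nest_bounded {x : ℕ} (hx : 2 ≤ x) {bs : List ℕ} (hbs : ∀ b ∈ bs, b < 2) {c : Program}
    (hc : c.Bounded) : (nest x bs c).Bounded := by
  induction bs generalizing x with
  | nil => exact hc
  | cons b bs ih =>
    refine ⟨hx, ?_, ih (by omega) fun b' hb' => hbs b' (List.mem_cons_of_mem _ hb')⟩
    have := hbs b (by simp)
    interval_cases b <;> simp

/-- The loops overwrite the registers from `x` on, so only those below `x` matter initially. The two
summands may differ as functions; they are compared only at register contents that the loops can
reach. -/
theorem nestSum_congr {ρ ρ' : ℕ → ℕ} {x : ℕ} {bs : List ℕ} (hbs : ∀ b ∈ bs, b < x)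
    {F F' : (ℕ → ℕ) → ℝ} (h : ∀ y < x, ρ y = ρ' y)
    (hF : ∀ σ σ' : ℕ → ℕ, (∀ y < x, σ y = ρ y) → (∀ y < x + bs.length, σ y = σ' y) →
      F σ = F' σ') :
    nestSum ρ x bs F = nestSum ρ' x bs F' := by
  induction bs generalizing ρ ρ' x with
  | nil => exact hF ρ ρ' (fun y _ => rfl) h
  | cons b bs ih =>
    simp only [nestSum, h b (hbs b (by simp))]
    refine Finset.sum_congr rfl fun i _ => ih
      (fun b' hb' => (hbs b' (List.mem_cons_of_mem _ hb')).trans (Nat.lt_succ_self x))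
      (fun y hy => ?_) fun σ σ' h1 h2 => hF σ σ' (fun y hy => ?_) fun y hy => h2 y ?_
    · rcases eq_or_ne y x with rfl | hne
      · simp
      · simp [Function.update_of_ne hne, h y (by omega)]
    · rw [h1 y (by omega), Function.update_of_ne (by omega)]
    · simp only [List.length_cons] at hy
      omega

theorem nestSum_zero (ρ : ℕ → ℕ) (x : ℕ) (bs : List ℕ) : nestSum ρ x bs (fun _ => 0) = 0 := by
  induction bs generalizing ρ x with
  | nil => rfl
  | cons b bs ih => simp [nestSum, ih]

/-- Since `e` does not read the array `a`, every increment can be evaluated in the original memory,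
and the total is a sum over the box. Inner loops leave stale values in registers from `x` on, so the
conclusion describes only registers below `x`. -/
theorem run_nest_increment {x a : ℕ} {bs : List ℕ} {idx : List NatExpr} {e : RealExpr} (s : State)
    (hbs : ∀ b ∈ bs, b < x) (hidx : (idx.map NatExpr.bound).foldr max 0 ≤ x + bs.length)
    (he : e.bound ≤ x + bs.length) (ha : a ∉ e.arrays) :
    let s' := ((nest x bs (increment a idx e)).run s).1
    (∀ y < x, s'.reg y = s.reg y) ∧ (∀ b ≠ a, s'.mem b = s.mem b) ∧
    ∀ J, s'.mem a J = s.mem a J + nestSum s.reg x bs fun ρ =>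
      if idx.map (NatExpr.eval ⟨ρ, s.mem⟩) = J then e.eval ⟨ρ, s.mem⟩ else 0 := by
  induction bs generalizing x s with
  | nil =>
    refine ⟨fun y _ => rfl, fun b hb => ?_, fun J => ?_⟩
    · simp [nest, increment, Program.run, State.setCell, Function.update_of_ne hb]
    · simp only [nest, increment, Program.run, State.setCell, nestSum, Function.update_self,
        RealExpr.eval]
      by_cases hJ : idx.map (NatExpr.eval s) = J
      · subst hJ
        simp
      · rw [Function.update_of_ne (fun h => hJ h.symm), if_neg hJ, add_zero]
  | cons b bs ih =>
    simp only [List.length_cons] at hidx he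
    have hbs' : ∀ b' ∈ bs, b' < x + 1 := fun b' hb' =>
      (hbs b' (List.mem_cons_of_mem _ hb')).trans (Nat.lt_succ_self x)
    let G : ℕ → List ℕ → ℝ := fun i J => nestSum (Function.update s.reg x i) (x + 1) bs fun ρ =>
      if idx.map (NatExpr.eval ⟨ρ, s.mem⟩) = J then e.eval ⟨ρ, s.mem⟩ else 0
    refine Program.loop_rule (fun N s' => (∀ y < x, s'.reg y = s.reg y) ∧
      (∀ b ≠ a, s'.mem b = s.mem b) ∧
      ∀ J, s'.mem a J = s.mem a J + ∑ i ∈ Finset.range N, G i J) x (.var b) _ s ?_ ?_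
    · simp
    · rintro i - s' ⟨h1, h2, h3⟩
      obtain ⟨k1, k2, k3⟩ := ih (x := x + 1) (s'.setReg x i) hbs' (by omega) (by omega)
      refine ⟨fun y hy => ?_, fun b hb => ?_, fun J => ?_⟩
      · rw [k1 y (by omega), s'.setReg_reg_of_ne _ (by omega), h1 y hy]
      · rw [k2 b hb, ← h2 b hb]
        rfl
      · rw [k3 J, Finset.sum_range_succ, ← add_assoc, ← h3 J]
        congr 1
        refine nestSum_congr hbs' (fun y hy => ?_) fun σ σ' _ hσ => ?_
        · rcases eq_or_ne y x with rfl | hne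
          · simp [State.setReg]
          · rw [s'.setReg_reg_of_ne _ hne, h1 y (by omega), Function.update_of_ne hne]
        · rw [NatExpr.map_eval_congr (s' := ⟨σ', s.mem⟩) idx fun y hy => hσ y (by omega),
            RealExpr.eval_congr (s := ⟨σ, (s'.setReg x i).mem⟩) (s' := ⟨σ', s.mem⟩) e
              (fun y hy => hσ y (by omega)) fun b hb => h2 b (ne_of_mem_of_not_mem hb ha)]

/-- Registers `x, x + 1, …` are set to the entries of a list. -/
def setRegs (ρ : ℕ → ℕ) (x : ℕ) : List ℕ → ℕ → ℕ
  | [] => ρ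
  | j :: J => setRegs (Function.update ρ x j) (x + 1) J

/-- The outer loop registers are the index of the cell written to, so the indicator keeps exactly
one term of each outer sum, the one prescribed by `J`; the inner sums remain. -/
theorem nestSum_ite {ρ : ℕ → ℕ} {x : ℕ} {outer inner J : List ℕ} {F : (ℕ → ℕ) → ℝ}
    (ho : ∀ b ∈ outer, b < x) (hi : ∀ b ∈ inner, b < x)
    (hF : ∀ σ σ' : ℕ → ℕ, (∀ y < x + (outer ++ inner).length, σ y = σ' y) → F σ = F σ')
    (hJ : List.Forall₂ (fun j b => j < ρ b) J outer) :
    nestSum ρ x (outer ++ inner)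
        (fun σ => if (List.range' x outer.length).map σ = J then F σ else 0) =
      nestSum (setRegs ρ x J) (x + outer.length) inner F := by
  induction outer generalizing ρ x J with
  | nil =>
    cases hJ
    simp [setRegs]
  | cons b outer ih =>
    obtain _ | ⟨hj, hJ⟩ := hJ
    rename_i j J
    have ho' : ∀ b' ∈ outer, b' < x + 1 := fun b' hb' =>
      (ho b' (List.mem_cons_of_mem _ hb')).trans (Nat.lt_succ_self x)
    have hi' : ∀ b' ∈ inner, b' < x + 1 := fun b' hb' => (hi b' hb').trans (Nat.lt_succ_self x)
    have hoi : ∀ b' ∈ outer ++ inner, b' < x + 1 := fun b' hb' =>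
      (List.mem_append.1 hb').elim (ho' b') (hi' b')
    have hF' : ∀ σ σ' : ℕ → ℕ, (∀ y < x + 1 + (outer ++ inner).length, σ y = σ' y) →
        F σ = F σ' := fun σ σ' h => hF σ σ' fun y hy => h y (by
          simp only [List.length_append, List.length_cons] at hy ⊢; omega)
    have hxo : x + (b :: outer).length = x + 1 + outer.length := by
      simp only [List.length_cons]; omega
    simp only [List.cons_append, nestSum, List.length_cons, List.range'_succ, List.map_cons,
      List.cons.injEq, setRegs]
    rw [Finset.sum_eq_single_of_mem j (Finset.mem_range.2 hj)]
    · have hJ' : List.Forall₂ (fun j' b' => j' < Function.update ρ x j b') J outer := by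
        clear ih hF hF' hoi hxo ho'
        induction hJ with
        | nil => exact .nil
        | @cons j' b' J outer h _ ih' =>
          refine .cons ?_ (ih' fun b'' hb'' => ho b'' ?_)
          · rw [Function.update_of_ne]
            · exact h
            · have := ho b' (by simp)
              omega
          · simp only [List.mem_cons] at hb'' ⊢
            tauto
      rw [List.length_cons] at hxo
      rw [hxo, ← ih ho' hi' hF' hJ']
      refine nestSum_congr hoi (fun _ _ => rfl) fun σ σ' h1 h2 => ?_
      have hx : σ x = j := by rw [h1 x (by omega), Function.update_self]
      have hm : (List.range' (x + 1) outer.length).map σ =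
          (List.range' (x + 1) outer.length).map σ' := List.map_congr_left fun y hy => by
        refine h2 y ?_
        rw [List.mem_range'_1] at hy
        simp only [List.length_append]; omega
      rw [hF' σ σ' h2, hm]
      simp [hx]
    · intro i _ hij
      refine Eq.trans ?_ (nestSum_zero (Function.update ρ x i) (x + 1) (outer ++ inner))
      refine nestSum_congr hoi (fun _ _ => rfl) fun σ σ' h1 _ => ?_
      have hx : σ x = i := by rw [h1 x (by omega), Function.update_self]
      rw [if_neg]
      rintro ⟨h, -⟩
      exact hij (hx.symm.trans h)

/-- `a[pre, J] += ∑ e`, for all `J` in the box with the dimensions `outer`, where the sum ranges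
over the box with the dimensions `inner`. -/
def accum (x a : ℕ) (pre outer inner : List ℕ) (e : RealExpr) : Program :=
  nest x (outer ++ inner)
    (increment a ((pre ++ List.range' x outer.length).map NatExpr.var) e)

theorem foldr_max_le {l : List ℕ} {k : ℕ} (h : ∀ y ∈ l, y ≤ k) : l.foldr max 0 ≤ k := by
  induction l with
  | nil => simp
  | cons y l ih =>
    simp only [List.foldr_cons, max_le_iff]
    exact ⟨h y (by simp), ih fun z hz => h z (by simp [hz])⟩

/-- The prefix `pre` consists of registers that the loops do not touch. It confines the writing to
one slice of the array, and the third clause says that the other slices survive. -/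
theorem run_accum {x a : ℕ} {pre outer inner : List ℕ} {e : RealExpr} (s : State)
    (hpre : ∀ y ∈ pre, y < x) (ho : ∀ b ∈ outer, b < x) (hi : ∀ b ∈ inner, b < x)
    (he : e.bound ≤ x + (outer ++ inner).length) (ha : a ∉ e.arrays) :
    let s' := ((accum x a pre outer inner e).run s).1
    (∀ y < x, s'.reg y = s.reg y) ∧ (∀ b ≠ a, s'.mem b = s.mem b) ∧
    (∀ J, (∀ J', J ≠ pre.map s.reg ++ J') → s'.mem a J = s.mem a J) ∧
    ∀ J, List.Forall₂ (fun j b => j < s.reg b) J outer →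
      s'.mem a (pre.map s.reg ++ J) = s.mem a (pre.map s.reg ++ J) +
        nestSum (setRegs s.reg x J) (x + outer.length) inner fun ρ => e.eval ⟨ρ, s.mem⟩ := by
  have hoi : ∀ b ∈ outer ++ inner, b < x := fun b hb =>
    (List.mem_append.1 hb).elim (ho b) (hi b)
  obtain ⟨h1, h2, h3⟩ := run_nest_increment (a := a)
    (idx := (pre ++ List.range' x outer.length).map NatExpr.var) s hoi (by
      refine foldr_max_le fun y hy => ?_
      simp only [List.map_map, List.mem_map, List.mem_append, List.mem_range'_1,
        Function.comp_apply, NatExpr.bound] at hy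
      obtain ⟨z, hz, rfl⟩ := hy
      simp only [List.length_append]
      rcases hz with hz | hz
      · have := hpre z hz
        omega
      · omega) he ha
  have hmap : ∀ σ : ℕ → ℕ, ((pre ++ List.range' x outer.length).map NatExpr.var).map
      (NatExpr.eval ⟨σ, s.mem⟩) = pre.map σ ++ (List.range' x outer.length).map σ := fun σ => by
    simp [Function.comp_def, NatExpr.eval]
  have hpre' : ∀ σ : ℕ → ℕ, (∀ y < x, σ y = s.reg y) → pre.map σ = pre.map s.reg := fun σ hσ =>
    List.map_congr_left fun y hy => hσ y (hpre y hy)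
  refine ⟨h1, h2, fun J hJ => ?_, fun J hJ => ?_⟩
  · refine (h3 J).trans (add_eq_left.2 ?_)
    refine Eq.trans ?_ (nestSum_zero s.reg x (outer ++ inner))
    refine nestSum_congr hoi (fun _ _ => rfl) fun σ σ' hσ _ => if_neg fun h => ?_
    rw [hmap, hpre' σ hσ] at h
    exact hJ _ h.symm
  · refine (h3 _).trans (congrArg _ ?_)
    have hF : ∀ σ σ' : ℕ → ℕ, (∀ y < x + (outer ++ inner).length, σ y = σ' y) →
        e.eval ⟨σ, s.mem⟩ = e.eval ⟨σ', s.mem⟩ := fun σ σ' h =>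
      e.eval_congr (fun y hy => h y (by omega)) fun _ _ => rfl
    rw [← nestSum_ite ho hi hF hJ]
    refine nestSum_congr hoi (fun _ _ => rfl) fun σ σ' h1 h2 => ?_
    have hm : (List.range' x outer.length).map σ =
        (List.range' x outer.length).map σ' := List.map_congr_left fun y hy => by
      refine h2 y ?_
      rw [List.mem_range'_1] at hy
      simp only [List.length_append]; omega
    rw [hF σ σ' h2, hmap, hpre' σ h1, hm]
    simp only [List.append_cancel_left_eq]

theorem accum_bounded {x a : ℕ} {pre outer inner : List ℕ} {e : RealExpr} (hx : 2 ≤ x)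
    (h : ∀ b ∈ outer ++ inner, b < 2) : (accum x a pre outer inner e).Bounded :=
  nest_bounded hx h trivial

/-! ### Straight-line programs of array definitions -/

/-- The definition `target[J] = ∑ e` of a new array. -/
structure ArrayDef where
  target : ℕ
  outer : List ℕ
  inner : List ℕ
  e : RealExpr

def defineArrays : List ArrayDef → Program
  | [] => .skip
  | o :: os => .seq (accum 2 o.target [] o.outer o.inner o.e) (defineArrays os)

/-- Every array is defined once, from arrays that are not defined later. -/
def ValidDefs : List ArrayDef → Prop
  | [] => True
  | o :: os => (∀ b ∈ o.outer ++ o.inner, b < 2) ∧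
      o.e.bound ≤ 2 + (o.outer ++ o.inner).length ∧
      (∀ c ∈ o.target :: os.map ArrayDef.target, c ∉ o.e.arrays) ∧
      o.target ∉ os.map ArrayDef.target ∧ ValidDefs os

theorem ValidDefs.bounded {os : List ArrayDef} (h : ValidDefs os) :
    (defineArrays os).Bounded := by
  induction os with
  | nil => trivial
  | cons o os ih => exact ⟨accum_bounded le_rfl h.1, ih h.2.2.2.2⟩

theorem setRegs_congr {ρ ρ' : ℕ → ℕ} {x : ℕ} (h : ∀ y < x, ρ y = ρ' y) (J : List ℕ) :
    ∀ y < x + J.length, setRegs ρ x J y = setRegs ρ' x J y := by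
  induction J generalizing ρ ρ' x with
  | nil => simpa [setRegs] using h
  | cons j J ih =>
    intro y hy
    simp only [List.length_cons] at hy
    refine ih (x := x + 1) (fun z hz => ?_) y (by omega)
    rcases eq_or_ne z x with rfl | hne
    · simp
    · simp [Function.update_of_ne hne, h z (by omega)]

/-- Targets start at zero, so accumulating amounts to defining. No array is written after it has
been read, so every right hand side may be evaluated in the final memory: the program turns into a
system of equations about a single memory. -/
theorem run_defineArrays {os : List ArrayDef} (hos : ValidDefs os) (s : State)
    (hs : ∀ o ∈ os, ∀ J, s.mem o.target J = 0) :
    let s' := ((defineArrays os).run s).1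
    (∀ y < 2, s'.reg y = s.reg y) ∧ (∀ b ∉ os.map ArrayDef.target, s'.mem b = s.mem b) ∧
    ∀ o ∈ os, ∀ J, List.Forall₂ (fun j b => j < s.reg b) J o.outer →
      s'.mem o.target J = nestSum (setRegs s.reg 2 J) (2 + o.outer.length) o.inner
        fun ρ => o.e.eval ⟨ρ, s'.mem⟩ := by
  induction os generalizing s with
  | nil => simp [defineArrays, Program.run]
  | cons o os ih =>
    obtain ⟨v1, v2, v3, v4, v5⟩ := hos
    have ho : ∀ b ∈ o.outer, b < 2 := fun b hb => v1 b (List.mem_append_left _ hb)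
    have hi : ∀ b ∈ o.inner, b < 2 := fun b hb => v1 b (List.mem_append_right _ hb)
    obtain ⟨a1, a2, -, a4⟩ := run_accum (x := 2) (pre := []) s (by simp) ho hi v2
      (v3 o.target (by simp))
    generalize hs₁ : ((accum 2 o.target [] o.outer o.inner o.e).run s).1 = s₁ at a1 a2 a4
    obtain ⟨b1, b2, b3⟩ := ih v5 s₁ fun o' ho' J => by
      rw [a2 _ fun h => v4 (h ▸ List.mem_map_of_mem ho')]
      exact hs o' (List.mem_cons_of_mem _ ho') J
    simp only [defineArrays, Program.run, hs₁]
    generalize ((defineArrays os).run s₁).1 = s₂ at b1 b2 b3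
    have hbox : ∀ {J l : List ℕ}, (∀ b ∈ l, b < 2) →
        List.Forall₂ (fun j b => j < s.reg b) J l → List.Forall₂ (fun j b => j < s₁.reg b) J l := by
      intro J l hl h
      induction h with
      | nil => exact .nil
      | @cons j b J l hjb _ ih' =>
        exact .cons (by rw [a1 b (hl b (by simp))]; exact hjb)
          (ih' fun b' hb' => hl b' (List.mem_cons_of_mem _ hb'))
    refine ⟨fun y hy => (b1 y hy).trans (a1 y hy), fun b hb => ?_, fun o' ho' J hJ => ?_⟩
    · simp only [List.map_cons, List.mem_cons, not_or] at hb
      rw [b2 b hb.2, a2 b hb.1]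
    · rcases List.mem_cons.1 ho' with rfl | ho''
      · have hlen : 2 + o'.outer.length = 2 + J.length := by rw [hJ.length_eq]
        have hz := a4 J hJ
        simp only [List.map_nil, List.nil_append] at hz
        rw [b2 _ v4, hz, hs o' (by simp) J, zero_add]
        refine nestSum_congr (fun b hb => (hi b hb).trans_le (by omega)) (fun _ _ => rfl)
          fun σ σ' _ hσ => ?_
        refine o'.e.eval_congr (fun y hy => hσ y ?_) fun b hb => ?_
        · simp only [List.length_append] at v2
          omega
        · have hb' : b ∉ o'.target :: os.map ArrayDef.target := fun h => v3 b h hb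
          simp only [List.mem_cons, not_or] at hb'
          exact ((b2 b hb'.2).trans (a2 b hb'.1)).symm
      · have hv : ∀ os, ValidDefs os → o' ∈ os → (∀ b ∈ o'.outer ++ o'.inner, b < 2) ∧
            o'.e.bound ≤ 2 + (o'.outer ++ o'.inner).length := by
          intro os
          induction os with
          | nil => simp
          | cons q os ih' =>
            intro h hq
            rcases List.mem_cons.1 hq with rfl | hq
            · exact ⟨h.1, h.2.1⟩
            · exact ih' h.2.2.2.2 hq
        obtain ⟨w1, w2⟩ := hv os v5 ho''
        have hlen : 2 + o'.outer.length = 2 + J.length := by rw [hJ.length_eq]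
        rw [b3 o' ho'' J (hbox (fun b hb => w1 b (List.mem_append_left _ hb)) hJ)]
        refine nestSum_congr
          (fun b hb => (w1 b (List.mem_append_right _ hb)).trans_le (by omega))
          (fun y hy => setRegs_congr a1 J y (by omega)) fun σ σ' _ hσ =>
            o'.e.eval_congr (fun y hy => hσ y ?_) fun _ _ => rfl
        simp only [List.length_append] at w2
        omega

/-! ### Gauss–Jordan elimination -/

section Elimination

variable {ι : Type*} [Fintype ι] [DecidableEq ι]

/-- The pivots in `S` have been eliminated from the system `A x = b`, and the resulting system
is `M x = g`. -/
def Eliminated (A : Matrix ι ι ℝ) (b : ι → ℝ) (S : Set ι) (M : Matrix ι ι ℝ) (g : ι → ℝ) : Prop :=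
  ∃ P : Matrix ι ι ℝ, A = P * M ∧ b = P.mulVec g ∧
    (∀ j ∉ S, ∀ i, P i j = (1 : Matrix ι ι ℝ) i j) ∧ ∀ j ∈ S, ∀ i, M i j = (1 : Matrix ι ι ℝ) i j

theorem Eliminated.empty (A : Matrix ι ι ℝ) (b : ι → ℝ) : Eliminated A b ∅ A b :=
  ⟨1, by simp, by simp, by simp, by simp⟩

/-- If the pivot were zero, some nonzero `x` supported on `S ∪ {p}` would be annihilated by the rows
of `M` in `S ∪ {p}`. Since `P` is trivial outside `S`, `A x = M x`, so `A x` vanishes on the support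
of `x` and `xᵀ A x = 0`, against positive definiteness. -/
theorem Eliminated.pivot_ne_zero {A M : Matrix ι ι ℝ} {b g : ι → ℝ} {S : Set ι} (hA : A.PosDef)
    (h : Eliminated A b S M g) {p : ι} (hp : p ∉ S) : M p p ≠ 0 := by
  classical
  obtain ⟨P, hPM, -, hP, hM⟩ := h
  intro h0
  -- Columns of `M` in `S` are unit vectors, so subtracting `M i p` in the coordinates `i ∈ S`
  -- cancels column `p` in those rows.
  let x : ι → ℝ := fun i => if i ∈ S then -M i p else if i = p then 1 else 0
  have hxp : x p = 1 := by simp [x, hp]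
  have hx : x ≠ 0 := fun h => by simp [h] at hxp
  have hr : ∀ i, i ∈ S ∨ i = p → M.mulVec x i = 0 := by
    intro i hi
    have : ∀ j, M i j * x j =
        (if j = p then M i p else 0) + if j = i then (if i ∈ S then -M i p else 0) else 0 := by
      intro j
      by_cases hj : j ∈ S
      · have hjp : j ≠ p := fun h => hp (h ▸ hj)
        by_cases hji : j = i
        · subst hji
          simp [x, hj, hM j hj, hjp]
        · simp [x, hj, hM j hj, hjp, hji, Matrix.one_apply_ne (Ne.symm hji)]
      · by_cases hjp : j = p
        · subst hjp
          by_cases hji : j = i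
          · subst hji
            simp [x, hj]
          · simp [x, hj, hji]
        · by_cases hji : j = i
          · exact absurd hi (by subst hji; simp [hj, hjp])
          · simp [x, hj, hjp, hji]
    rw [Matrix.mulVec, dotProduct, Finset.sum_congr rfl fun j _ => this j, Finset.sum_add_distrib]
    simp only [Finset.sum_ite_eq', Finset.mem_univ, if_true]
    rcases hi with hi | rfl
    · simp [hi]
    · simp [hp, h0]
  have hAx : ∀ i, A.mulVec x i = M.mulVec x i := by
    intro i
    rw [hPM, ← Matrix.mulVec_mulVec]
    conv_lhs => rw [Matrix.mulVec, dotProduct]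
    rw [Finset.sum_eq_single i]
    · by_cases hi : i ∈ S
      · rw [hr i (.inl hi), mul_zero]
      · rw [hP i hi, Matrix.one_apply_eq, one_mul]
    · intro j _ hj
      by_cases hjS : j ∈ S
      · rw [hr j (.inl hjS), mul_zero]
      · rw [hP j hjS, Matrix.one_apply_ne hj.symm, zero_mul]
    · simp
  have hpos := hA.dotProduct_mulVec_pos hx
  refine hpos.ne' (Finset.sum_eq_zero fun i _ => ?_)
  by_cases hi : i ∈ S ∨ i = p
  · rw [hAx, hr i hi, mul_zero]
  · simp only [not_or] at hi
    simp [x, hi.1, hi.2]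

/-- The elimination is undone by the matrix `E` that is the identity except for its column `p`,
which is column `p` of `M`: `M = E * M'` and `g = E g'`. Hence `P * E` is the new left factor. The
formula treats all rows alike; for `i = p` it divides the pivot row by the pivot. -/
theorem Eliminated.step {A M M' : Matrix ι ι ℝ} {b g g' : ι → ℝ} {S : Set ι} {p : ι}
    (h : Eliminated A b S M g) (hp : M p p ≠ 0)
    (hM' : ∀ i j, M' i j = M i j + ((1 : Matrix ι ι ℝ) i p - M i p) * M p j / M p p)
    (hg' : ∀ i, g' i = g i + ((1 : Matrix ι ι ℝ) i p - M i p) * g p / M p p) :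
    Eliminated A b (insert p S) M' g' := by
  obtain ⟨P, hPM, hPg, hP, hM⟩ := h
  let E : Matrix ι ι ℝ := 1 + Matrix.vecMulVec (fun i => M i p - (1 : Matrix ι ι ℝ) i p)
    (Pi.single p 1)
  have hE : ∀ i j, E i j = (1 : Matrix ι ι ℝ) i j +
      (M i p - (1 : Matrix ι ι ℝ) i p) * (Pi.single p 1 : ι → ℝ) j := fun i j => rfl
  have hEv : ∀ (v : ι → ℝ) i, ∑ j, E i j * v j =
      v i + (M i p - (1 : Matrix ι ι ℝ) i p) * v p := by
    intro v i
    simp only [hE, add_mul, Finset.sum_add_distrib]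
    congr 1
    · exact congrFun (Matrix.one_mulVec v) i
    · rw [Finset.sum_eq_single p]
      · simp
      · intro j _ hj
        simp [hj]
      · simp
  refine ⟨P * E, ?_, ?_, ?_, ?_⟩
  · rw [Matrix.mul_assoc, hPM]
    congr 1
    ext i j
    rw [Matrix.mul_apply, hEv fun k => M' k j, hM', hM' p, Matrix.one_apply_eq]
    field_simp
    ring
  · rw [← Matrix.mulVec_mulVec, hPg]
    congr 1
    ext i
    rw [Matrix.mulVec, dotProduct, hEv, hg', hg' p, Matrix.one_apply_eq]
    field_simp
    ring
  · intro j hj i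
    simp only [Set.mem_insert_iff, not_or] at hj
    rw [← hP j hj.2 i, Matrix.mul_apply, Finset.sum_eq_single j]
    · simp [hE, hj.1]
    · intro k _ hk
      simp [hE, hj.1, hk]
    · simp
  · intro j hj i
    rcases eq_or_ne j p with rfl | hne
    · rw [hM']
      field_simp
      ring
    · have hjS : j ∈ S := hj.resolve_left hne
      rw [hM', hM j hjS, hM j hjS, Matrix.one_apply_ne hne.symm]
      simp

/-- Once every column of `M` is a unit vector, `M = 1`, so `P = A` and `b = A g`. -/
theorem Eliminated.solution {A M : Matrix ι ι ℝ} {b g : ι → ℝ} (hA : A.PosDef)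
    (h : Eliminated A b Set.univ M g) : g = A⁻¹.mulVec b := by
  obtain ⟨P, hPM, hPg, -, hM⟩ := h
  have hM1 : M = 1 := by
    ext i j
    exact hM j trivial i
  rw [hM1, Matrix.mul_one] at hPM
  rw [hPg, ← hPM, Matrix.mulVec_mulVec, Matrix.nonsing_inv_mul _ hA.det_pos.ne'.isUnit,
    Matrix.one_mulVec]

end Elimination

/-! ### The elimination program

The matrix of the system is in the array `25` of rank four and the right hand side in the array
`23` of rank two. The arrays `26` and `27` hold the updates of the two, one for each pivot. The
array `5` holds the indicator function of zero. -/

/-- The Kronecker delta of two registers. -/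
def deltaExpr (x y : ℕ) : RealExpr :=
  .cell 5 [.add (.sub (.var x) (.var y)) (.sub (.var y) (.var x))]

/-- The cell of the array `a` whose index is in the given registers. -/
def cellAt (a : ℕ) (xs : List ℕ) : RealExpr := .cell a (xs.map .var)

/-- The factor of the pivot row in the elimination of the pivot `(2, 3)` from row `(4, 5)`. -/
def pivotFactor : RealExpr :=
  .sub (.mul (deltaExpr 5 3) (deltaExpr 4 2)) (cellAt 25 [4, 5, 2, 3])

/-- All updates read the old pivot row and column, so they are stored in `26` and `27` before any
entry of `25` or `23` changes. Accumulation can only add, so each pivot gets its own slice, which is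
still zero. -/
def eliminatePivot : Program :=
  .seq (accum 4 26 [2, 3] [1, 0, 1, 0] []
      (.div (.mul pivotFactor (cellAt 25 [2, 3, 6, 7])) (cellAt 25 [2, 3, 2, 3])))
    (.seq (accum 4 27 [2, 3] [1, 0] []
        (.div (.mul pivotFactor (cellAt 23 [2, 3])) (cellAt 25 [2, 3, 2, 3])))
      (.seq (accum 4 25 [] [1, 0, 1, 0] [] (cellAt 26 [2, 3, 4, 5, 6, 7]))
        (accum 4 23 [] [1, 0] [] (cellAt 27 [2, 3, 4, 5]))))

def eliminateAll : Program := .loop 2 (.var 1) (.loop 3 (.var 0) eliminatePivot)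

theorem eliminateAll_bounded : eliminateAll.Bounded := by
  simp only [eliminateAll, eliminatePivot, Program.Bounded, le_refl, true_or, or_true, true_and,
    Nat.reduceLeDiff]
  refine ⟨?_, ?_, ?_, ?_⟩ <;> exact accum_bounded (by decide) (by decide)

/-- The array holds the indicator function of zero. -/
def IsIndicator (m : List ℕ → ℝ) : Prop := ∀ k : ℕ, m [k] = if k = 0 then 1 else 0

/-- With truncated subtraction, `(x - y) + (y - x)` is the distance of the two numbers, which is
zero exactly if they agree. -/
theorem eval_deltaExpr {s : State} (h : IsIndicator (s.mem 5)) (x y : ℕ) :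
    (deltaExpr x y).eval s = if s.reg x = s.reg y then 1 else 0 := by
  simp only [deltaExpr, RealExpr.eval, List.map_cons, List.map_nil, NatExpr.eval, h _]
  congr 1
  simp only [eq_iff_iff]
  omega

theorem eval_cellAt (s : State) (a : ℕ) (xs : List ℕ) :
    (cellAt a xs).eval s = s.mem a (xs.map s.reg) := by
  simp [cellAt, RealExpr.eval, Function.comp_def, NatExpr.eval]

/-- The matrix in the array `a` of rank four. -/
def arrayMatrix {n d : ℕ} (s : State) (a : ℕ) : Matrix (Fin d × Fin n) (Fin d × Fin n) ℝ :=
  Matrix.of fun p q => s.mem a [(p.1 : ℕ), (p.2 : ℕ), (q.1 : ℕ), (q.2 : ℕ)]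

/-- The vector in the array `a` of rank two. -/
def arrayVec {n d : ℕ} (s : State) (a : ℕ) : Fin d × Fin n → ℝ :=
  fun p => s.mem a [(p.1 : ℕ), (p.2 : ℕ)]

/-- The state of the elimination program after the elimination of the pivots in `S`. -/
structure ElimState {n d : ℕ} (A : Matrix (Fin d × Fin n) (Fin d × Fin n) ℝ)
    (b : Fin d × Fin n → ℝ) (mem : ℕ → List ℕ → ℝ) (S : Set (Fin d × Fin n)) (s : State) :
    Prop where
  reg_zero : s.reg 0 = n
  reg_one : s.reg 1 = d
  mem_eq : ∀ c, c ≠ 23 → c ≠ 25 → c ≠ 26 → c ≠ 27 → s.mem c = mem c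
  -- The slices of pivots still to come are zero, so that accumulating into them stores the update
  -- itself.
  fresh : ∀ p ∉ S, ∀ J, s.mem 26 ((p.1 : ℕ) :: (p.2 : ℕ) :: J) = 0 ∧
    s.mem 27 ((p.1 : ℕ) :: (p.2 : ℕ) :: J) = 0
  eliminated : Eliminated A b S (arrayMatrix s 25) (arrayVec s 23)

/-- The statement about register `2` serves the inner loop, which sets register `3` only and relies
on the row index of the pivot being preserved. -/
theorem ElimState.eliminatePivot {n d : ℕ} {A : Matrix (Fin d × Fin n) (Fin d × Fin n) ℝ}
    {b : Fin d × Fin n → ℝ} {mem : ℕ → List ℕ → ℝ} {S : Set (Fin d × Fin n)} {s : State}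
    (hA : A.PosDef) (hδ : IsIndicator (mem 5)) (h : ElimState A b mem S s) {p : Fin d × Fin n}
    (hp : p ∉ S) (h2 : s.reg 2 = p.1) (h3 : s.reg 3 = p.2) :
    ElimState A b mem (insert p S) (eliminatePivot.run s).1 ∧
      (eliminatePivot.run s).1.reg 2 = p.1 := by
  have hpiv := h.eliminated.pivot_ne_zero hA hp
  obtain ⟨r0, r1, hm, hf, he⟩ := h
  have hδs : IsIndicator (s.mem 5) := by
    rw [hm 5 (by decide) (by decide) (by decide) (by decide)]
    exact hδ
  simp only [AttentionInversion.eliminatePivot, Program.run]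
  obtain ⟨a1, a2, a3, a4⟩ := run_accum (x := 4) (a := 26) (pre := [2, 3]) (outer := [1, 0, 1, 0])
    (inner := []) (e := .div (.mul pivotFactor (cellAt 25 [2, 3, 6, 7])) (cellAt 25 [2, 3, 2, 3]))
    s (by decide) (by decide) (by decide) (by decide) (by decide)
  generalize ((accum 4 26 [2, 3] [1, 0, 1, 0] [] (.div (.mul pivotFactor
    (cellAt 25 [2, 3, 6, 7])) (cellAt 25 [2, 3, 2, 3]))).run s).1 = s₁ at a1 a2 a3 a4 ⊢
  obtain ⟨b1, b2, b3, b4⟩ := run_accum (x := 4) (a := 27) (pre := [2, 3]) (outer := [1, 0])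
    (inner := []) (e := .div (.mul pivotFactor (cellAt 23 [2, 3])) (cellAt 25 [2, 3, 2, 3]))
    s₁ (by decide) (by decide) (by decide) (by decide) (by decide)
  generalize ((accum 4 27 [2, 3] [1, 0] [] (.div (.mul pivotFactor
    (cellAt 23 [2, 3])) (cellAt 25 [2, 3, 2, 3]))).run s₁).1 = s₂ at b1 b2 b3 b4 ⊢
  obtain ⟨c1, c2, -, c4⟩ := run_accum (x := 4) (a := 25) (pre := []) (outer := [1, 0, 1, 0])
    (inner := []) (e := cellAt 26 [2, 3, 4, 5, 6, 7])
    s₂ (by decide) (by decide) (by decide) (by decide) (by decide)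
  generalize ((accum 4 25 [] [1, 0, 1, 0] [] (cellAt 26 [2, 3, 4, 5, 6, 7])).run s₂).1 = s₃
    at c1 c2 c4 ⊢
  obtain ⟨d1, d2, -, d4⟩ := run_accum (x := 4) (a := 23) (pre := []) (outer := [1, 0])
    (inner := []) (e := cellAt 27 [2, 3, 4, 5])
    s₃ (by decide) (by decide) (by decide) (by decide) (by decide)
  generalize ((accum 4 23 [] [1, 0] [] (cellAt 27 [2, 3, 4, 5])).run s₃).1 = s₄ at d1 d2 d4 ⊢
  have hδ₁ : IsIndicator (s₁.mem 5) := by rwa [a2 5 (by decide)]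
  have R : ∀ y < 4, s₁.reg y = s.reg y ∧ s₂.reg y = s.reg y ∧ s₃.reg y = s.reg y ∧
      s₄.reg y = s.reg y := fun y hy => by
    rw [d1 y hy, c1 y hy, b1 y hy, a1 y hy]
    simp
  have hU : ∀ i j : Fin d × Fin n,
      s₁.mem 26 [(p.1 : ℕ), (p.2 : ℕ), (i.1 : ℕ), (i.2 : ℕ), (j.1 : ℕ), (j.2 : ℕ)] =
      ((1 : Matrix (Fin d × Fin n) (Fin d × Fin n) ℝ) i p - arrayMatrix s 25 i p) *
        arrayMatrix s 25 p j / arrayMatrix s 25 p p := by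
    intro i j
    have := a4 [(i.1 : ℕ), (i.2 : ℕ), (j.1 : ℕ), (j.2 : ℕ)] (by simp [r0, r1])
    simp only [List.map_cons, List.map_nil, h2, h3, List.cons_append, List.nil_append,
      (hf p hp _).1, zero_add, nestSum, RealExpr.eval, pivotFactor, eval_cellAt, setRegs] at this
    rw [this, eval_deltaExpr (by exact hδs), eval_deltaExpr (by exact hδs)]
    simp [Function.update, h2, h3, arrayMatrix, Matrix.one_apply, Prod.ext_iff, Fin.ext_iff,
      ite_and]
  have hu : ∀ i : Fin d × Fin n,
      s₂.mem 27 [(p.1 : ℕ), (p.2 : ℕ), (i.1 : ℕ), (i.2 : ℕ)] =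
      ((1 : Matrix (Fin d × Fin n) (Fin d × Fin n) ℝ) i p - arrayMatrix s 25 i p) *
        arrayVec s 23 p / arrayMatrix s 25 p p := by
    intro i
    have := b4 [(i.1 : ℕ), (i.2 : ℕ)] (by simp [r0, r1, R])
    simp only [List.map_cons, List.map_nil, h2, h3, List.cons_append, List.nil_append,
      zero_add, nestSum, RealExpr.eval, pivotFactor, eval_cellAt, setRegs, R, Nat.reduceLT,
      a2 25 (by decide), a2 23 (by decide), a2 27 (by decide), (hf p hp _).2] at this
    rw [this, eval_deltaExpr (by exact hδ₁), eval_deltaExpr (by exact hδ₁)]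
    simp [Function.update, h2, h3, arrayMatrix, arrayVec, Matrix.one_apply, Prod.ext_iff,
      Fin.ext_iff, R, ite_and]
  refine ⟨⟨?_, ?_, ?_, ?_, ?_⟩, ?_⟩
  · rw [(R 0 (by decide)).2.2.2, r0]
  · rw [(R 1 (by decide)).2.2.2, r1]
  · intro c h23 h25 h26 h27
    rw [d2 c h23, c2 c h25, b2 c h27, a2 c h26, hm c h23 h25 h26 h27]
  · intro q hq J
    simp only [Set.mem_insert_iff, not_or] at hq
    have hne : ∀ J', ((q.1 : ℕ) :: (q.2 : ℕ) :: J) ≠ [(p.1 : ℕ), (p.2 : ℕ)] ++ J' := by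
      intro J' h
      simp only [List.cons_append, List.nil_append, List.cons.injEq] at h
      exact hq.1 (Prod.ext (Fin.ext h.1) (Fin.ext h.2.1))
    rw [d2 26 (by decide), c2 26 (by decide), b2 26 (by decide), d2 27 (by decide),
      c2 27 (by decide)]
    have hR := R 2 (by decide)
    have hR' := R 3 (by decide)
    rw [a3 _ (by simpa [h2, h3] using hne), b3 _ (by simpa [h2, h3, hR.1, hR'.1] using hne),
      a2 27 (by decide)]
    exact hf q hq.2 J
  · refine he.step hpiv (fun i j => ?_) fun i => ?_
    · have := c4 [(i.1 : ℕ), (i.2 : ℕ), (j.1 : ℕ), (j.2 : ℕ)] (by simp [r0, r1, R])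
      simp [nestSum, eval_cellAt, setRegs, Function.update, R, h2, h3, b2, a2] at this
      rw [← hU, arrayMatrix, arrayMatrix]
      simpa [d2] using this
    · have := d4 [(i.1 : ℕ), (i.2 : ℕ)] (by simp [r0, r1, R])
      simp [nestSum, eval_cellAt, setRegs, Function.update, R, h2, h3, c2, b2, a2] at this
      rw [← hu, arrayVec, arrayVec]
      exact this
  · rw [(R 2 (by decide)).2.2.2, h2]

theorem run_eliminateAll {n d : ℕ} {s : State} (h0 : s.reg 0 = n) (h1 : s.reg 1 = d)
    (hδ : IsIndicator (s.mem 5)) (h26 : ∀ J, s.mem 26 J = 0) (h27 : ∀ J, s.mem 27 J = 0)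
    (hA : (arrayMatrix (n := n) (d := d) s 25).PosDef) :
    arrayVec (n := n) (d := d) (eliminateAll.run s).1 23 =
      (arrayMatrix s 25)⁻¹.mulVec (arrayVec s 23) ∧
    (eliminateAll.run s).1.reg 0 = n ∧ (eliminateAll.run s).1.reg 1 = d ∧
    (eliminateAll.run s).1.mem 4 = s.mem 4 := by
  have key := Program.loop_rule (fun a s' => ElimState (n := n) (d := d) (arrayMatrix s 25)
      (arrayVec s 23) s.mem {p | (p.1 : ℕ) < a} s') 2 (.var 1) (.loop 3 (.var 0) eliminatePivot) s
    ⟨h0, h1, fun _ _ _ _ _ => rfl, fun _ _ _ => ⟨h26 _, h27 _⟩, by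
      simpa using Eliminated.empty (arrayMatrix s 25) (arrayVec s 23)⟩ ?_
  · have hu : {p : Fin d × Fin n | (p.1 : ℕ) < NatExpr.eval s (.var 1)} = Set.univ := by
      ext p
      simp [NatExpr.eval, h1]
    rw [hu] at key
    exact ⟨key.eliminated.solution hA, key.reg_zero, key.reg_one,
      key.mem_eq 4 (by decide) (by decide) (by decide) (by decide)⟩
  · intro a ha s' hs'
    have ha' : a < d := by simpa [NatExpr.eval, h1] using ha
    have hset : ∀ (s : State) (S : Set (Fin d × Fin n)) (x v : ℕ), 2 ≤ x → ∀ {A b mem},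
        ElimState A b mem S s → ElimState A b mem S (s.setReg x v) := by
      intro s S x v hx A b mem h
      exact ⟨by rw [s.setReg_reg_of_ne _ (by omega), h.reg_zero],
        by rw [s.setReg_reg_of_ne _ (by omega), h.reg_one], h.mem_eq, h.fresh, h.eliminated⟩
    -- Pivots are taken in lexicographic order: before round `b` of row `a`, those eliminated are
    -- the pairs before `(a, b)`.
    have inner := Program.loop_rule (fun b s' => ElimState (n := n) (d := d) (arrayMatrix s 25)
      (arrayVec s 23) s.mem {p | (p.1 : ℕ) < a ∨ (p.1 : ℕ) = a ∧ (p.2 : ℕ) < b} s' ∧ s'.reg 2 = a)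
      3 (.var 0) eliminatePivot (s'.setReg 2 a) ⟨by simpa using hset s' _ 2 a le_rfl hs',
        by simp [State.setReg]⟩ ?_
    · have hu : {p : Fin d × Fin n | (p.1 : ℕ) < a ∨ (p.1 : ℕ) = a ∧
          (p.2 : ℕ) < NatExpr.eval (s'.setReg 2 a) (.var 0)} = {p | (p.1 : ℕ) < a + 1} := by
        ext p
        have hn : (s'.setReg 2 a).reg 0 = n := hs'.reg_zero
        have := p.2.isLt
        simp only [NatExpr.eval, hn, Set.mem_ofPred_eq]
        omega
      rw [hu] at inner
      exact inner.1
    · rintro b hb s'' ⟨hs'', h2⟩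
      have hn : (s'.setReg 2 a).reg 0 = n := hs'.reg_zero
      have hb' : b < n := by simpa [NatExpr.eval, hn] using hb
      have := (hset s'' _ 3 b (by decide) hs'').eliminatePivot hA hδ
        (p := (⟨a, ha'⟩, ⟨b, hb'⟩)) (by simp) (by rw [s''.setReg_reg_of_ne _ (by decide), h2])
        (by simp [State.setReg])
      refine ⟨?_, this.2⟩
      convert this.1 using 1
      ext p
      simp only [Set.mem_ofPred_eq, Set.mem_insert_iff, Prod.ext_iff, Fin.ext_iff]
      omega

/-! ### The first two derivatives of the loss -/

section Derivatives

variable {n d : ℕ}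

/-- The entries of `Xᵀ W X`. -/
def scores (W : Matrix (Fin d) (Fin d) ℝ) (X : Matrix (Fin d) (Fin n) ℝ) (i j : Fin n) : ℝ :=
  ∑ a, ∑ b, X a i * W a b * X b j

/-- The entries of the row-wise softmax of `Xᵀ W X`. -/
noncomputable def weight (W : Matrix (Fin d) (Fin d) ℝ) (X : Matrix (Fin d) (Fin n) ℝ)
    (i j : Fin n) : ℝ :=
  Real.exp (scores W X i j) / ∑ k, Real.exp (scores W X i k)

/-- The entries of `Xᵀ V`. -/
def value (V : Matrix (Fin d) (Fin d) ℝ) (X : Matrix (Fin d) (Fin n) ℝ) (j : Fin n) (c : Fin d) :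
    ℝ :=
  ∑ a, X a j * V a c

/-- The entries of the attention matrix. -/
noncomputable def attn (W V : Matrix (Fin d) (Fin d) ℝ) (X : Matrix (Fin d) (Fin n) ℝ)
    (i : Fin n) (c : Fin d) : ℝ :=
  ∑ j, weight W X i j * value V X j c

/-- The derivative of `scores` in the direction `U`. -/
def scoresD (W : Matrix (Fin d) (Fin d) ℝ) (X U : Matrix (Fin d) (Fin n) ℝ) (i j : Fin n) : ℝ :=
  ∑ a, ∑ b, (U a i * W a b * X b j + X a i * W a b * U b j)

/-- The second derivative of `scores` in the directions `U` and `U'`. -/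
def scoresDD (W : Matrix (Fin d) (Fin d) ℝ) (U U' : Matrix (Fin d) (Fin n) ℝ) (i j : Fin n) : ℝ :=
  ∑ a, ∑ b, (U a i * W a b * U' b j + U' a i * W a b * U b j)

noncomputable def meanD (W : Matrix (Fin d) (Fin d) ℝ) (X U : Matrix (Fin d) (Fin n) ℝ)
    (i : Fin n) : ℝ :=
  ∑ j, weight W X i j * scoresD W X U i j

/-- The derivative of `weight` in the direction `U`. -/
noncomputable def weightD (W : Matrix (Fin d) (Fin d) ℝ) (X U : Matrix (Fin d) (Fin n) ℝ)
    (i j : Fin n) : ℝ :=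
  weight W X i j * (scoresD W X U i j - meanD W X U i)

/-- The derivative of `meanD` in the direction `U'`. -/
noncomputable def meanDD (W : Matrix (Fin d) (Fin d) ℝ) (X U U' : Matrix (Fin d) (Fin n) ℝ)
    (i : Fin n) : ℝ :=
  ∑ j, (weightD W X U' i j * scoresD W X U i j + weight W X i j * scoresDD W U U' i j)

/-- The second derivative of `weight` in the directions `U` and `U'`. -/
noncomputable def weightDD (W : Matrix (Fin d) (Fin d) ℝ) (X U U' : Matrix (Fin d) (Fin n) ℝ)
    (i j : Fin n) : ℝ :=
  weightD W X U' i j * (scoresD W X U i j - meanD W X U i) +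
    weight W X i j * (scoresDD W U U' i j - meanDD W X U U' i)

/-- The derivative of `attn` in the direction `U`. -/
noncomputable def attnD (W V : Matrix (Fin d) (Fin d) ℝ) (X U : Matrix (Fin d) (Fin n) ℝ)
    (i : Fin n) (c : Fin d) : ℝ :=
  ∑ j, (weightD W X U i j * value V X j c + weight W X i j * value V U j c)

/-- The second derivative of `attn` in the directions `U` and `U'`. -/
noncomputable def attnDD (W V : Matrix (Fin d) (Fin d) ℝ) (X U U' : Matrix (Fin d) (Fin n) ℝ)
    (i : Fin n) (c : Fin d) : ℝ :=
  ∑ j, (weightDD W X U U' i j * value V X j c + weightD W X U i j * value V U' j c +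
    weightD W X U' i j * value V U j c)

/-- The derivative of the loss in the direction `U`. -/
noncomputable def lossD (W V : Matrix (Fin d) (Fin d) ℝ) (B : Matrix (Fin n) (Fin d) ℝ) (γ : ℝ)
    (X U : Matrix (Fin d) (Fin n) ℝ) : ℝ :=
  ∑ i, ∑ c, 2 * (attn W V X i c - B i c) * attnD W V X U i c + 2 * γ * ∑ a, ∑ j, X a j * U a j

/-- The second derivative, in the directions `U` and `U'`, of the loss without the regularizing
term. -/
noncomputable def fitDD (W V : Matrix (Fin d) (Fin d) ℝ) (B : Matrix (Fin n) (Fin d) ℝ)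
    (X U U' : Matrix (Fin d) (Fin n) ℝ) : ℝ :=
  ∑ i, ∑ c, 2 * (attnD W V X U i c * attnD W V X U' i c +
    (attn W V X i c - B i c) * attnDD W V X U U' i c)

/-- The second derivative of the loss in the directions `U` and `U'`. -/
noncomputable def lossDD (W V : Matrix (Fin d) (Fin d) ℝ) (B : Matrix (Fin n) (Fin d) ℝ) (γ : ℝ)
    (X U U' : Matrix (Fin d) (Fin n) ℝ) : ℝ :=
  fitDD W V B X U U' + 2 * γ * ∑ a, ∑ j, U a j * U' a j

variable (W V : Matrix (Fin d) (Fin d) ℝ) (B : Matrix (Fin n) (Fin d) ℝ) (γ : ℝ)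
  (X U U' : Matrix (Fin d) (Fin n) ℝ) (t : ℝ)

theorem sum_exp_pos (i : Fin n) : 0 < ∑ k, Real.exp (scores W X i k) :=
  Finset.sum_pos (fun _ _ => Real.exp_pos _) ⟨i, Finset.mem_univ i⟩

theorem frobNorm_sq {p q : ℕ} (A : Matrix (Fin p) (Fin q) ℝ) :
    frobNorm A ^ 2 = ∑ i, ∑ j, A i j ^ 2 :=
  Real.sq_sqrt (Finset.sum_nonneg fun _ _ => Finset.sum_nonneg fun _ _ => sq_nonneg _)

/-- The row sums of exponentials are positive, so the matrix inverse is the diagonal matrix of their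
reciprocals, and the product is row-wise softmax applied to the values. -/
theorem regLoss_eq : regLoss W V B γ X =
    ∑ i, ∑ c, (attn W V X i c - B i c) ^ 2 + γ * ∑ a, ∑ j, X a j ^ 2 := by
  have hS : ∀ i j, expScores W X i j = Real.exp (scores W X i j) := by
    intro i j
    simp only [expScores, Matrix.map_apply, Matrix.mul_apply, Matrix.transpose_apply, scores,
      Finset.sum_mul]
    rw [Finset.sum_comm]
  have hD : normalizer W X = Matrix.diagonal fun i => ∑ k, Real.exp (scores W X i k) := by
    ext i j
    simp [normalizer, Matrix.diagonal_apply, Matrix.mulVec, dotProduct, hS]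
  have hinv : (normalizer W X)⁻¹ =
      Matrix.diagonal fun i => (∑ k, Real.exp (scores W X i k))⁻¹ := by
    refine Matrix.inv_eq_right_inv ?_
    rw [hD, Matrix.diagonal_mul_diagonal, ← Matrix.diagonal_one]
    congr 1
    ext i
    exact mul_inv_cancel₀ (sum_exp_pos W X i).ne'
  rw [regLoss, frobNorm_sq]
  congr 1
  refine Finset.sum_congr rfl fun i _ => Finset.sum_congr rfl fun c _ => ?_
  rw [Matrix.sub_apply, Matrix.mul_assoc, Matrix.mul_apply, attn]
  congr 2
  refine Finset.sum_congr rfl fun j _ => ?_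
  rw [hinv, Matrix.diagonal_mul, hS, Matrix.mul_apply, weight, value, div_eq_inv_mul]
  rfl

theorem sum_weight (i : Fin n) : ∑ j, weight W X i j = 1 := by
  simp only [weight, ← Finset.sum_div]
  exact div_self (sum_exp_pos W X i).ne'

theorem weight_nonneg (i j : Fin n) : 0 ≤ weight W X i j :=
  div_nonneg (Real.exp_pos _).le (sum_exp_pos W X i).le

theorem hasDerivAt_entry (a : Fin d) (i : Fin n) :
    HasDerivAt (fun t : ℝ => (X + t • U) a i) (U a i) t := by
  simpa using ((hasDerivAt_id t).mul_const (U a i)).const_add (X a i)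

/-- The derivatives along a line are recorded at every `t`, not only at `0`, so that the mean value
theorem can be applied along a segment. -/
theorem hasDerivAt_scores (i j : Fin n) :
    HasDerivAt (fun t : ℝ => scores W (X + t • U) i j) (scoresD W (X + t • U) U i j) t := by
  refine HasDerivAt.fun_sum fun a _ => HasDerivAt.fun_sum fun b _ => ?_
  exact ((hasDerivAt_entry X U t a i).mul_const _).mul (hasDerivAt_entry X U t b j)

theorem hasDerivAt_scoresD (i j : Fin n) :
    HasDerivAt (fun t : ℝ => scoresD W (X + t • U') U i j) (scoresDD W U U' i j) t := by
  refine HasDerivAt.fun_sum fun a _ => HasDerivAt.fun_sum fun b _ => ?_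
  exact ((hasDerivAt_entry X U' t b j).const_mul _).add
    (((hasDerivAt_entry X U' t a i).mul_const _).mul_const _)

theorem hasDerivAt_weight (i j : Fin n) :
    HasDerivAt (fun t : ℝ => weight W (X + t • U) i j) (weightD W (X + t • U) U i j) t := by
  have h := (hasDerivAt_scores W X U t i j).exp.div
    (HasDerivAt.fun_sum fun k (_ : k ∈ Finset.univ) => (hasDerivAt_scores W X U t i k).exp)
    (sum_exp_pos W (X + t • U) i).ne'
  refine h.congr_deriv ?_
  have hm : meanD W (X + t • U) U i = (∑ k, Real.exp (scores W (X + t • U) i k) *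
      scoresD W (X + t • U) U i k) / ∑ k, Real.exp (scores W (X + t • U) i k) := by
    rw [meanD, Finset.sum_div]
    exact Finset.sum_congr rfl fun k _ => by rw [weight, div_mul_eq_mul_div]
  have hZ := (sum_exp_pos W (X + t • U) i).ne'
  rw [weightD, hm, weight]
  field_simp

theorem hasDerivAt_value (j : Fin n) (c : Fin d) :
    HasDerivAt (fun t : ℝ => value V (X + t • U) j c) (value V U j c) t :=
  HasDerivAt.fun_sum fun a _ => (hasDerivAt_entry X U t a j).mul_const _

theorem hasDerivAt_meanD (i : Fin n) :
    HasDerivAt (fun t : ℝ => meanD W (X + t • U') U i) (meanDD W (X + t • U') U U' i) t :=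
  HasDerivAt.fun_sum fun j _ =>
    (hasDerivAt_weight W X U' t i j).mul (hasDerivAt_scoresD W X U U' t i j)

theorem hasDerivAt_weightD (i j : Fin n) :
    HasDerivAt (fun t : ℝ => weightD W (X + t • U') U i j) (weightDD W (X + t • U') U U' i j) t :=
  (hasDerivAt_weight W X U' t i j).mul
    ((hasDerivAt_scoresD W X U U' t i j).sub (hasDerivAt_meanD W X U U' t i))

theorem hasDerivAt_attn (i : Fin n) (c : Fin d) :
    HasDerivAt (fun t : ℝ => attn W V (X + t • U) i c) (attnD W V (X + t • U) U i c) t :=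
  HasDerivAt.fun_sum fun j _ =>
    (hasDerivAt_weight W X U t i j).mul (hasDerivAt_value V X U t j c)

theorem hasDerivAt_attnD (i : Fin n) (c : Fin d) :
    HasDerivAt (fun t : ℝ => attnD W V (X + t • U') U i c)
      (attnDD W V (X + t • U') U U' i c) t :=
  HasDerivAt.fun_sum fun j _ =>
    ((hasDerivAt_weightD W X U U' t i j).mul (hasDerivAt_value V X U' t j c)).add
      ((hasDerivAt_weight W X U' t i j).mul_const (value V U j c))

theorem hasDerivAt_regLoss :
    HasDerivAt (fun t : ℝ => regLoss W V B γ (X + t • U)) (lossD W V B γ (X + t • U) U) t := by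
  simp only [regLoss_eq]
  refine HasDerivAt.add (HasDerivAt.fun_sum fun i _ => HasDerivAt.fun_sum fun c _ => ?_) ?_
  · exact (((hasDerivAt_attn W V X U t i c).sub_const (B i c)).fun_pow 2).congr_deriv
      (by push_cast; ring)
  · refine ((HasDerivAt.fun_sum fun a _ => HasDerivAt.fun_sum fun j _ =>
      (hasDerivAt_entry X U t a j).pow 2).const_mul γ).congr_deriv ?_
    simp only [Finset.mul_sum]
    exact Finset.sum_congr rfl fun a _ => Finset.sum_congr rfl fun j _ => by ring

theorem hasDerivAt_lossD :
    HasDerivAt (fun t : ℝ => lossD W V B γ (X + t • U') U)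
      (lossDD W V B γ (X + t • U') U U') t := by
  refine HasDerivAt.add (HasDerivAt.fun_sum fun i _ => HasDerivAt.fun_sum fun c _ => ?_)
    ((HasDerivAt.fun_sum fun a _ => HasDerivAt.fun_sum fun j _ => ?_).const_mul (2 * γ))
  · refine ((((hasDerivAt_attn W V X U' t i c).sub_const (B i c)).const_mul 2).mul
      (hasDerivAt_attnD W V X U U' t i c)).congr_deriv ?_
    ring
  · exact ((hasDerivAt_entry X U' t a j).mul_const (U a j)).congr_deriv (mul_comm _ _)

theorem lineDeriv_regLoss : lineDeriv ℝ (regLoss W V B γ) X U = lossD W V B γ X U := by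
  simpa [lineDeriv] using (hasDerivAt_regLoss W V B γ X U 0).deriv

theorem lineDeriv_lossD :
    lineDeriv ℝ (fun X => lossD W V B γ X U) X U' = lossDD W V B γ X U U' := by
  simpa [lineDeriv] using (hasDerivAt_lossD W V B γ X U U' 0).deriv

/-- The coordinate direction with index `p`. -/
def unit (p : Fin d × Fin n) : Matrix (Fin d) (Fin n) ℝ := Matrix.single p.1 p.2 1

theorem unit_apply (p : Fin d × Fin n) (a : Fin d) (j : Fin n) :
    unit p a j = if a = p.1 ∧ j = p.2 then 1 else 0 := by
  simp [unit, Matrix.single_apply, eq_comm]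

theorem gradVec_apply (p : Fin d × Fin n) :
    gradVec (regLoss W V B γ) X p = lossD W V B γ X (unit p) :=
  lineDeriv_regLoss W V B γ X (unit p)

theorem hessian_apply (p q : Fin d × Fin n) :
    hessian (regLoss W V B γ) X p q = lossDD W V B γ X (unit q) (unit p) := by
  have : partialDeriv (regLoss W V B γ) q = fun X => lossD W V B γ X (unit q) :=
    funext fun X => lineDeriv_regLoss W V B γ X (unit q)
  simp only [hessian, Matrix.of_apply, this]
  exact lineDeriv_lossD W V B γ X (unit q) (unit p)

-- Symmetry of the second derivative, and the Hessian as a bilinear form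

attribute [local instance] Matrix.normedAddCommGroup Matrix.normedSpace

theorem contDiff_regLoss :
    ContDiff ℝ 2 (regLoss W V B γ : Matrix (Fin d) (Fin n) ℝ → ℝ) := by
  have he : ∀ a i, ContDiff ℝ 2 fun X : Matrix (Fin d) (Fin n) ℝ => X a i :=
    fun a i => contDiff_apply_apply ℝ ℝ a i
  have hs : ∀ i j, ContDiff ℝ 2 fun X : Matrix (Fin d) (Fin n) ℝ => scores W X i j := fun i j =>
    ContDiff.sum fun a _ => ContDiff.sum fun b _ => ((he a i).mul contDiff_const).mul (he b j)
  have hw : ∀ i j, ContDiff ℝ 2 fun X : Matrix (Fin d) (Fin n) ℝ => weight W X i j := fun i j =>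
    (hs i j).exp.div (ContDiff.sum fun k _ => (hs i k).exp) fun X => (sum_exp_pos W X i).ne'
  have ha : ∀ i c, ContDiff ℝ 2 fun X : Matrix (Fin d) (Fin n) ℝ => attn W V X i c := fun i c =>
    ContDiff.sum fun j _ => (hw i j).mul (ContDiff.sum fun a _ => (he a j).mul contDiff_const)
  rw [funext (regLoss_eq W V B γ)]
  exact (ContDiff.sum fun i _ => ContDiff.sum fun c _ => ((ha i c).sub contDiff_const).pow 2).add
    (contDiff_const.mul (ContDiff.sum fun a _ => ContDiff.sum fun j _ => (he a j).pow 2))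

theorem lossD_eq_fderiv : lossD W V B γ X U = fderiv ℝ (regLoss W V B γ) X U := by
  rw [← lineDeriv_regLoss]
  exact ((contDiff_regLoss W V B γ).differentiable (by norm_num) X).lineDeriv_eq_fderiv

theorem lossDD_eq_fderiv :
    lossDD W V B γ X U U' = fderiv ℝ (fderiv ℝ (regLoss W V B γ)) X U' U := by
  have h : Differentiable ℝ (fderiv ℝ (regLoss W V B γ : Matrix (Fin d) (Fin n) ℝ → ℝ)) :=
    ((contDiff_regLoss W V B γ).fderiv_right (m := 1) (by norm_num)).differentiable (by norm_num)
  rw [← lineDeriv_lossD, funext fun X => lossD_eq_fderiv W V B γ X U]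
  have h' := (h X).hasFDerivAt.clm_apply (hasFDerivAt_const U X)
  refine h'.differentiableAt.lineDeriv_eq_fderiv.trans ?_
  rw [h'.fderiv]
  change fderiv ℝ (regLoss W V B γ) X 0 + _ = _
  rw [map_zero, zero_add]
  rfl

/-- The explicit formula is not visibly symmetric in its two directions; symmetry comes from
Schwarz's theorem for the `C²` loss. -/
theorem lossDD_comm : lossDD W V B γ X U U' = lossDD W V B γ X U' U := by
  rw [lossDD_eq_fderiv, lossDD_eq_fderiv]
  have h : IsSymmSndFDerivAt ℝ (regLoss W V B γ) X :=
    (contDiff_regLoss W V B γ).contDiffAt.isSymmSndFDerivAt (by simp)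
  exact h U' U

/-- The matrix with given entries. -/
def toMatrix (u : Fin d × Fin n → ℝ) : Matrix (Fin d) (Fin n) ℝ := Matrix.of fun a j => u (a, j)

theorem toMatrix_eq_sum (u : Fin d × Fin n → ℝ) : toMatrix u = ∑ p, u p • unit p := by
  ext a j
  rw [Matrix.sum_apply, Finset.sum_eq_single (a, j)]
  · simp [toMatrix, unit_apply]
  · intro p _ hp
    simp only [Matrix.smul_apply, unit_apply]
    rw [if_neg fun h => hp (Prod.ext h.1.symm h.2.symm), smul_zero]
  · simp

open Matrix in
theorem dotProduct_gradVec (u : Fin d × Fin n → ℝ) :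
    u ⬝ᵥ gradVec (regLoss W V B γ) X = lossD W V B γ X (toMatrix u) := by
  rw [lossD_eq_fderiv, toMatrix_eq_sum, map_sum]
  simp only [map_smul, ← lossD_eq_fderiv, dotProduct, gradVec_apply, smul_eq_mul]

open Matrix in
theorem dotProduct_hessian (u v : Fin d × Fin n → ℝ) :
    u ⬝ᵥ (hessian (regLoss W V B γ) X).mulVec v =
      lossDD W V B γ X (toMatrix u) (toMatrix v) := by
  rw [lossDD_comm, lossDD_eq_fderiv, toMatrix_eq_sum, toMatrix_eq_sum, map_sum]
  simp only [_root_.sum_apply, map_sum, map_smul, _root_.smul_apply,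
    ← lossDD_eq_fderiv, dotProduct, Matrix.mulVec, hessian_apply, smul_eq_mul, Finset.mul_sum]
  rw [Finset.sum_comm]
  exact Finset.sum_congr rfl fun q _ => Finset.sum_congr rfl fun p _ => by ring

theorem hessian_isSymm : (hessian (regLoss W V B γ) X).IsSymm := by
  ext p q
  rw [Matrix.transpose_apply, hessian_apply, hessian_apply, lossDD_comm]

end Derivatives

/-! ### The Frobenius norm -/

section Frobenius

variable {p q : ℕ} (A A' : Matrix (Fin p) (Fin q) ℝ)

/-- The Frobenius inner product. -/
def frobInner (A A' : Matrix (Fin p) (Fin q) ℝ) : ℝ := ∑ i, ∑ j, A i j * A' i j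

theorem frobNorm_nonneg : 0 ≤ frobNorm A := Real.sqrt_nonneg _

theorem frobInner_self : frobInner A A = frobNorm A ^ 2 := by
  rw [frobNorm_sq, frobInner]
  simp only [sq]

theorem abs_frobInner_le : |frobInner A A'| ≤ frobNorm A * frobNorm A' := by
  refine abs_le_of_sq_le_sq ?_ (mul_nonneg (frobNorm_nonneg A) (frobNorm_nonneg A'))
  rw [mul_pow, frobNorm_sq, frobNorm_sq, frobInner]
  simp only [← Fintype.sum_prod_type']
  exact Finset.sum_mul_sq_le_sq_mul_sq _ _ _

theorem frobNorm_add_le : frobNorm (A + A') ≤ frobNorm A + frobNorm A' := by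
  refine le_of_sq_le_sq ?_ (add_nonneg (frobNorm_nonneg A) (frobNorm_nonneg A'))
  have h : frobNorm (A + A') ^ 2 = frobNorm A ^ 2 + 2 * frobInner A A' + frobNorm A' ^ 2 := by
    simp only [frobNorm_sq, frobInner, Matrix.add_apply, Finset.mul_sum,
      ← Finset.sum_add_distrib]
    exact Finset.sum_congr rfl fun i _ => Finset.sum_congr rfl fun j _ => by ring
  rw [h]
  nlinarith [le_abs_self (frobInner A A'), abs_frobInner_le A A']

theorem frobNorm_smul (r : ℝ) : frobNorm (r • A) = |r| * frobNorm A := by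
  rw [← abs_of_nonneg (frobNorm_nonneg (r • A)), ← abs_of_nonneg (frobNorm_nonneg A), ← abs_mul,
    ← sq_eq_sq_iff_abs_eq_abs, mul_pow, frobNorm_sq, frobNorm_sq]
  simp only [Matrix.smul_apply, smul_eq_mul, mul_pow, Finset.mul_sum]

theorem frobNorm_neg : frobNorm (-A) = frobNorm A := by
  simp [frobNorm]

theorem sum_column_sq_le (j : Fin q) : ∑ i, A i j ^ 2 ≤ frobNorm A ^ 2 := by
  rw [frobNorm_sq]
  exact Finset.sum_le_sum fun i _ =>
    Finset.single_le_sum (f := fun j => A i j ^ 2) (fun _ _ => sq_nonneg _) (Finset.mem_univ j)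

end Frobenius

/-! ### Bounds for the second derivative of the loss -/

section Bounds

variable {n d : ℕ} {W V : Matrix (Fin d) (Fin d) ℝ} {B : Matrix (Fin n) (Fin d) ℝ} {R : ℝ}
  {X : Matrix (Fin d) (Fin n) ℝ} (U U' : Matrix (Fin d) (Fin n) ℝ)

/-- Cauchy–Schwarz for the Frobenius product of `W` with the rank-one matrix formed from column `i`
of `U` and column `j` of `U'`. -/
theorem abs_bilinear_le (W : Matrix (Fin d) (Fin d) ℝ) (i j : Fin n) :
    |∑ a, ∑ b, U a i * W a b * U' b j| ≤ frobNorm W * (frobNorm U * frobNorm U') := by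
  have h := abs_frobInner_le W (Matrix.of fun a b => U a i * U' b j)
  have heq : frobInner W (Matrix.of fun a b => U a i * U' b j) =
      ∑ a, ∑ b, U a i * W a b * U' b j :=
    Finset.sum_congr rfl fun a _ => Finset.sum_congr rfl fun b _ => by
      rw [Matrix.of_apply]; ring
  rw [heq] at h
  refine h.trans (mul_le_mul_of_nonneg_left ?_ (frobNorm_nonneg W))
  refine le_of_sq_le_sq ?_ (mul_nonneg (frobNorm_nonneg U) (frobNorm_nonneg U'))
  rw [frobNorm_sq, mul_pow]
  simp only [Matrix.of_apply, mul_pow, ← Finset.mul_sum, ← Finset.sum_mul]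
  exact mul_le_mul (sum_column_sq_le U i) (sum_column_sq_le U' j)
    (Finset.sum_nonneg fun _ _ => sq_nonneg _) (sq_nonneg _)

theorem abs_value_le (V : Matrix (Fin d) (Fin d) ℝ) (j : Fin n) (c : Fin d) :
    |value V U j c| ≤ frobNorm U * frobNorm V := by
  refine abs_le_of_sq_le_sq ?_ (mul_nonneg (frobNorm_nonneg U) (frobNorm_nonneg V))
  rw [mul_pow]
  exact (Finset.sum_mul_sq_le_sq_mul_sq _ _ _).trans
    (mul_le_mul (sum_column_sq_le U j) (sum_column_sq_le V c)
      (Finset.sum_nonneg fun _ _ => sq_nonneg _) (sq_nonneg _))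

/-- An average with the softmax weights. -/
theorem abs_sum_le_of_weight (W : Matrix (Fin d) (Fin d) ℝ) (X : Matrix (Fin d) (Fin n) ℝ)
    (i : Fin n) {f : Fin n → ℝ} {K : ℝ} (h : ∀ j, |f j| ≤ weight W X i j * K) :
    |∑ j, f j| ≤ K := by
  calc |∑ j, f j| ≤ ∑ j, |f j| := Finset.abs_sum_le_sum_abs _ _
    _ ≤ ∑ j, weight W X i j * K := Finset.sum_le_sum fun j _ => h j
    _ = K := by rw [← Finset.sum_mul, sum_weight, one_mul]

variable (hR : 1 < R) (hW : frobNorm W ≤ R) (hV : frobNorm V ≤ R) (hX : frobNorm X ≤ 2 * R)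
include hR hW hX

theorem abs_scoresD_le (i j : Fin n) : |scoresD W X U i j| ≤ 4 * R ^ 2 * frobNorm U := by
  have h1 := abs_bilinear_le U X W i j
  have h2 := abs_bilinear_le X U W i j
  have hU := frobNorm_nonneg U
  have h3 : frobNorm W * (frobNorm U * frobNorm X) ≤ R * (frobNorm U * (2 * R)) := by
    have := frobNorm_nonneg X
    gcongr
  simp only [scoresD, Finset.sum_add_distrib]
  refine (abs_add_le _ _).trans ?_
  rw [mul_comm (frobNorm X)] at h2
  nlinarith

omit hR hX in
theorem abs_scoresDD_le (i j : Fin n) :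
    |scoresDD W U U' i j| ≤ 2 * R * (frobNorm U * frobNorm U') := by
  have h1 := abs_bilinear_le U U' W i j
  have h2 := abs_bilinear_le U' U W i j
  have h3 := mul_le_mul_of_nonneg_right hW (mul_nonneg (frobNorm_nonneg U) (frobNorm_nonneg U'))
  simp only [scoresDD, Finset.sum_add_distrib]
  refine (abs_add_le _ _).trans ?_
  rw [mul_comm (frobNorm U')] at h2
  nlinarith

theorem abs_meanD_le (i : Fin n) : |meanD W X U i| ≤ 4 * R ^ 2 * frobNorm U :=
  abs_sum_le_of_weight W X i fun j => by
    rw [abs_mul, abs_of_nonneg (weight_nonneg W X i j)]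
    exact mul_le_mul_of_nonneg_left (abs_scoresD_le U hR hW hX i j) (weight_nonneg W X i j)

theorem abs_scoresD_sub_le (i j : Fin n) :
    |scoresD W X U i j - meanD W X U i| ≤ 8 * R ^ 2 * frobNorm U := by
  refine (abs_sub _ _).trans ?_
  linarith [abs_scoresD_le U hR hW hX i j, abs_meanD_le U hR hW hX i]

/-- The weight is kept as a factor in this bound and in that of `weightDD`, so that a later sum over
`j` is an average and gains no factor `n`. -/
theorem abs_weightD_le (i j : Fin n) :
    |weightD W X U i j| ≤ weight W X i j * (8 * R ^ 2 * frobNorm U) := by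
  rw [weightD, abs_mul, abs_of_nonneg (weight_nonneg W X i j)]
  exact mul_le_mul_of_nonneg_left (abs_scoresD_sub_le U hR hW hX i j) (weight_nonneg W X i j)

theorem abs_meanDD_le (i : Fin n) :
    |meanDD W X U U' i| ≤ 34 * R ^ 4 * (frobNorm U * frobNorm U') := by
  refine abs_sum_le_of_weight W X i fun j => ?_
  have hw := weight_nonneg W X i j
  have hU := frobNorm_nonneg U
  have hU' := frobNorm_nonneg U'
  have hR4 : R ≤ R ^ 4 := le_self_pow₀ hR.le (by norm_num)
  calc _ ≤ |weightD W X U' i j| * |scoresD W X U i j| +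
        weight W X i j * |scoresDD W U U' i j| := by
        refine (abs_add_le _ _).trans ?_
        rw [abs_mul, abs_mul, abs_of_nonneg hw]
    _ ≤ weight W X i j * (8 * R ^ 2 * frobNorm U') * (4 * R ^ 2 * frobNorm U) +
        weight W X i j * (2 * R ^ 4 * (frobNorm U * frobNorm U')) := by
        gcongr
        · exact abs_weightD_le U' hR hW hX i j
        · exact abs_scoresD_le U hR hW hX i j
        · exact (abs_scoresDD_le U U' hW i j).trans (by gcongr)
    _ = weight W X i j * (34 * R ^ 4 * (frobNorm U * frobNorm U')) := by ring

theorem abs_weightDD_le (i j : Fin n) :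
    |weightDD W X U U' i j| ≤ weight W X i j * (100 * R ^ 4 * (frobNorm U * frobNorm U')) := by
  have hw := weight_nonneg W X i j
  have hU := frobNorm_nonneg U
  have hU' := frobNorm_nonneg U'
  have hR4 : R ≤ R ^ 4 := le_self_pow₀ hR.le (by norm_num)
  calc _ ≤ |weightD W X U' i j| * |scoresD W X U i j - meanD W X U i| +
        weight W X i j * (|scoresDD W U U' i j| + |meanDD W X U U' i|) := by
        refine (abs_add_le _ _).trans ?_
        rw [abs_mul, abs_mul, abs_of_nonneg hw]
        gcongr
        exact abs_sub _ _
    _ ≤ weight W X i j * (8 * R ^ 2 * frobNorm U') * (8 * R ^ 2 * frobNorm U) +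
        weight W X i j * (2 * R ^ 4 * (frobNorm U * frobNorm U') +
          34 * R ^ 4 * (frobNorm U * frobNorm U')) := by
        gcongr
        · exact abs_weightD_le U' hR hW hX i j
        · exact abs_scoresD_sub_le U hR hW hX i j
        · exact (abs_scoresDD_le U U' hW i j).trans (by gcongr)
        · exact abs_meanDD_le U U' hR hW hX i
    _ = weight W X i j * (100 * R ^ 4 * (frobNorm U * frobNorm U')) := by ring

include hV

omit hW in
theorem abs_value_le' (j : Fin n) (c : Fin d) : |value V X j c| ≤ 2 * R ^ 2 := by
  refine (abs_value_le X V j c).trans ?_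
  have := mul_le_mul hX hV (frobNorm_nonneg V) (by linarith)
  linarith

omit hW in
theorem abs_attn_le (i : Fin n) (c : Fin d) : |attn W V X i c| ≤ 2 * R ^ 2 :=
  abs_sum_le_of_weight W X i fun j => by
    rw [abs_mul, abs_of_nonneg (weight_nonneg W X i j)]
    exact mul_le_mul_of_nonneg_left (abs_value_le' hR hV hX j c) (weight_nonneg W X i j)

theorem abs_attnD_le (i : Fin n) (c : Fin d) :
    |attnD W V X U i c| ≤ 17 * R ^ 4 * frobNorm U := by
  refine abs_sum_le_of_weight W X i fun j => ?_
  have hw := weight_nonneg W X i j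
  have hU := frobNorm_nonneg U
  have hR4 : R ≤ R ^ 4 := le_self_pow₀ hR.le (by norm_num)
  calc _ ≤ |weightD W X U i j| * |value V X j c| + weight W X i j * |value V U j c| := by
        refine (abs_add_le _ _).trans ?_
        rw [abs_mul, abs_mul, abs_of_nonneg hw]
    _ ≤ weight W X i j * (8 * R ^ 2 * frobNorm U) * (2 * R ^ 2) +
        weight W X i j * (frobNorm U * R ^ 4) := by
        gcongr
        · exact abs_weightD_le U hR hW hX i j
        · exact abs_value_le' hR hV hX j c
        · exact (abs_value_le U V j c).trans (by gcongr; exact hV.trans hR4)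
    _ = weight W X i j * (17 * R ^ 4 * frobNorm U) := by ring

theorem abs_attnDD_le (i : Fin n) (c : Fin d) :
    |attnDD W V X U U' i c| ≤ 216 * R ^ 6 * (frobNorm U * frobNorm U') := by
  refine abs_sum_le_of_weight W X i fun j => ?_
  have hw := weight_nonneg W X i j
  have hU := frobNorm_nonneg U
  have hU' := frobNorm_nonneg U'
  have hR4 : R ≤ R ^ 4 := le_self_pow₀ hR.le (by norm_num)
  have hV4 : frobNorm V ≤ R ^ 4 := hV.trans hR4
  calc _ ≤ |weightDD W X U U' i j| * |value V X j c| + |weightD W X U i j| * |value V U' j c| +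
        |weightD W X U' i j| * |value V U j c| := by
        refine (abs_add_three _ _ _).trans ?_
        rw [abs_mul, abs_mul, abs_mul]
    _ ≤ weight W X i j * (100 * R ^ 4 * (frobNorm U * frobNorm U')) * (2 * R ^ 2) +
        weight W X i j * (8 * R ^ 2 * frobNorm U) * (frobNorm U' * R ^ 4) +
        weight W X i j * (8 * R ^ 2 * frobNorm U') * (frobNorm U * R ^ 4) := by
        gcongr
        · exact abs_weightDD_le U U' hR hW hX i j
        · exact abs_value_le' hR hV hX j c
        · exact abs_weightD_le U hR hW hX i j
        · exact (abs_value_le U' V j c).trans (by gcongr)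
        · exact abs_weightD_le U' hR hW hX i j
        · exact (abs_value_le U V j c).trans (by gcongr)
    _ = weight W X i j * (216 * R ^ 6 * (frobNorm U * frobNorm U')) := by ring

theorem abs_fitDD_le (hB : ∀ i c, |B i c| ≤ R) :
    |fitDD W V B X U U'| ≤ 2000 * n * d * R ^ 8 * (frobNorm U * frobNorm U') := by
  have hU := frobNorm_nonneg U
  have hU' := frobNorm_nonneg U'
  have hR2 : R ≤ R ^ 2 := le_self_pow₀ hR.le (by norm_num)
  have key : ∀ i c, |2 * (attnD W V X U i c * attnD W V X U' i c +
      (attn W V X i c - B i c) * attnDD W V X U U' i c)| ≤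
      2000 * R ^ 8 * (frobNorm U * frobNorm U') := by
    intro i c
    calc _ ≤ 2 * (|attnD W V X U i c| * |attnD W V X U' i c| +
          (|attn W V X i c| + |B i c|) * |attnDD W V X U U' i c|) := by
          rw [abs_mul, abs_two]
          gcongr
          refine (abs_add_le _ _).trans ?_
          rw [abs_mul, abs_mul]
          gcongr
          exact abs_sub _ _
      _ ≤ 2 * ((17 * R ^ 4 * frobNorm U) * (17 * R ^ 4 * frobNorm U') +
          (2 * R ^ 2 + R ^ 2) * (216 * R ^ 6 * (frobNorm U * frobNorm U'))) := by
          gcongr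
          · exact abs_attnD_le U hR hW hV hX i c
          · exact abs_attnD_le U' hR hW hV hX i c
          · exact abs_attn_le hR hV hX i c
          · exact (hB i c).trans hR2
          · exact abs_attnDD_le U U' hR hW hV hX i c
      -- `1874 = 2 * (17 * 17 + 3 * 216)`.
      _ = 1874 * R ^ 8 * (frobNorm U * frobNorm U') := by ring
      _ ≤ 2000 * R ^ 8 * (frobNorm U * frobNorm U') := by
          gcongr
          norm_num
  calc |fitDD W V B X U U'| ≤ ∑ _i : Fin n, ∑ _c : Fin d,
        2000 * R ^ 8 * (frobNorm U * frobNorm U') :=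
        (Finset.abs_sum_le_sum_abs _ _).trans (Finset.sum_le_sum fun i _ =>
          (Finset.abs_sum_le_sum_abs _ _).trans (Finset.sum_le_sum fun c _ => key i c))
    _ = 2000 * n * d * R ^ 8 * (frobNorm U * frobNorm U') := by
        simp
        ring

end Bounds

open Matrix

/-! ### Contraction of approximate Newton steps -/

/-- Polarization: a bound on the quadratic form of a symmetric matrix bounds its bilinear form with
the same constant. -/
theorem abs_dotProduct_mulVec_le {ι : Type*} [Fintype ι] {K : Matrix ι ι ℝ} {c : ℝ}
    (hK : K.IsSymm) (h : ∀ u : ι → ℝ, |u ⬝ᵥ K.mulVec u| ≤ c * (u ⬝ᵥ u)) (u v : ι → ℝ) {a b : ℝ}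
    (ha : 0 ≤ a) (hb : 0 ≤ b) (hu : u ⬝ᵥ u = a ^ 2) (hv : v ⬝ᵥ v = b ^ 2) :
    |u ⬝ᵥ K.mulVec v| ≤ c * (a * b) := by
  have hcomm : v ⬝ᵥ K.mulVec u = u ⬝ᵥ K.mulVec v := by
    rw [dotProduct_mulVec, ← mulVec_transpose, hK.eq, dotProduct_comm]
  have hzero : ∀ w : ι → ℝ, w ⬝ᵥ w = 0 → w = 0 := fun w hw => dotProduct_self_eq_zero.1 hw
  rcases ha.eq_or_lt with rfl | ha
  · rw [hzero u (by simpa using hu)]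
    simp
  rcases hb.eq_or_lt with rfl | hb
  · rw [hzero v (by simpa using hv)]
    simp
  -- The scaling gives both vectors norm `a * b`. The difference of the two quadratic forms is `4 *
  -- a * b` times `u ⬝ᵥ K.mulVec v`, and the two squared norms add up to `4 * (a * b) ^ 2`.
  have h1 := abs_le.1 (h (b • u + a • v))
  have h2 := abs_le.1 (h (b • u - a • v))
  simp only [mulVec_add, mulVec_sub, mulVec_smul, dotProduct_add, add_dotProduct, dotProduct_sub,
    sub_dotProduct, smul_dotProduct, dotProduct_smul, smul_eq_mul, hcomm, hu, hv,
    dotProduct_comm v u] at h1 h2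
  have hab : 0 < a * b := mul_pos ha hb
  refine abs_le.2 ⟨?_, ?_⟩
  · refine le_of_mul_le_mul_left ?_ hab
    nlinarith
  · refine le_of_mul_le_mul_left ?_ hab
    nlinarith

section Newton

variable {n d : ℕ} {W V : Matrix (Fin d) (Fin d) ℝ} {B : Matrix (Fin n) (Fin d) ℝ} {R γ : ℝ}

/-- The vector of the entries of a matrix. -/
def toVec (U : Matrix (Fin d) (Fin n) ℝ) : Fin d × Fin n → ℝ := fun p => U p.1 p.2

theorem dotProduct_eq_frobInner (u v : Fin d × Fin n → ℝ) :
    u ⬝ᵥ v = frobInner (toMatrix u) (toMatrix v) := by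
  simp only [dotProduct, Fintype.sum_prod_type, frobInner, toMatrix, Matrix.of_apply]

theorem dotProduct_self_eq_frobNorm (u : Fin d × Fin n → ℝ) :
    u ⬝ᵥ u = frobNorm (toMatrix u) ^ 2 := by
  rw [dotProduct_eq_frobInner, frobInner_self]

/-- The parameters of the loss satisfy the bounds of the theorem. -/
structure Admissible (W V : Matrix (Fin d) (Fin d) ℝ) (B : Matrix (Fin n) (Fin d) ℝ)
    (R γ : ℝ) : Prop where
  one_le_n : 1 ≤ n
  one_le_d : 1 ≤ d
  one_lt : 1 < R
  norm_W : frobNorm W ≤ R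
  norm_V : frobNorm V ≤ R
  abs_B : ∀ i j, |B i j| ≤ R
  le_γ : 100000 * n * d * R ^ 8 ≤ γ

namespace Admissible

variable (h : Admissible W V B R γ)
include h

theorem nd_le : 100000 * ((n : ℝ) * d) ≤ γ := by
  have h8 : 1 ≤ R ^ 8 := one_le_pow₀ h.one_lt.le
  have : (0 : ℝ) ≤ 100000 * n * d := by positivity
  nlinarith [h.le_γ]

theorem nd_pos : (0 : ℝ) < n * d := by
  have h1 : (1 : ℝ) ≤ n := by exact_mod_cast h.one_le_n
  have h2 : (1 : ℝ) ≤ d := by exact_mod_cast h.one_le_d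
  positivity

theorem γ_pos : 0 < γ := by
  linarith [h.nd_le, h.nd_pos]

/-- The constant is `2000 / 100000 = 0.02`. -/
theorem abs_lossDD_sub_le {X : Matrix (Fin d) (Fin n) ℝ} (hX : frobNorm X ≤ 2 * R)
    (U U' : Matrix (Fin d) (Fin n) ℝ) :
    |lossDD W V B γ X U U' - 2 * γ * frobInner U U'| ≤
      0.02 * γ * (frobNorm U * frobNorm U') := by
  have h1 : lossDD W V B γ X U U' - 2 * γ * frobInner U U' = fitDD W V B X U U' := by
    rw [lossDD, frobInner, add_sub_cancel_right]
  rw [h1]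
  refine (abs_fitDD_le U U' h.one_lt h.norm_W h.norm_V hX h.abs_B).trans ?_
  have := h.le_γ
  exact mul_le_mul_of_nonneg_right (by linarith)
    (mul_nonneg (frobNorm_nonneg U) (frobNorm_nonneg U'))

theorem quadratic_bounds {X : Matrix (Fin d) (Fin n) ℝ} (hX : frobNorm X ≤ 2 * R)
    (u : Fin d × Fin n → ℝ) :
    1.98 * γ * (u ⬝ᵥ u) ≤ u ⬝ᵥ (hessian (regLoss W V B γ) X).mulVec u ∧
      u ⬝ᵥ (hessian (regLoss W V B γ) X).mulVec u ≤ 2.02 * γ * (u ⬝ᵥ u) := by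
  have := abs_le.1 (h.abs_lossDD_sub_le hX (toMatrix u) (toMatrix u))
  rw [← dotProduct_hessian, ← dotProduct_eq_frobInner, ← sq, ← dotProduct_self_eq_frobNorm] at this
  constructor <;> linarith

theorem hessian_posDef {X : Matrix (Fin d) (Fin n) ℝ} (hX : frobNorm X ≤ 2 * R) :
    (hessian (regLoss W V B γ) X).PosDef := by
  refine Matrix.PosDef.of_dotProduct_mulVec_pos ?_ fun u hu => ?_
  · rw [Matrix.IsHermitian, conjTranspose_eq_transpose_of_trivial]
    exact hessian_isSymm W V B γ X
  · rw [star_trivial]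
    have hpos : 0 < u ⬝ᵥ u :=
      lt_of_le_of_ne (Finset.sum_nonneg fun _ _ => mul_self_nonneg _)
        fun h0 => hu (dotProduct_self_eq_zero.1 h0.symm)
    have := h.γ_pos
    exact lt_of_lt_of_le (by positivity) (h.quadratic_bounds hX u).1

omit h in
theorem lossD_eq_zero {Xs : Matrix (Fin d) (Fin n) ℝ}
    (hmin : ∀ X, regLoss W V B γ Xs ≤ regLoss W V B γ X) (U : Matrix (Fin d) (Fin n) ℝ) :
    lossD W V B γ Xs U = 0 := by
  have hd := hasDerivAt_regLoss W V B γ Xs U 0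
  have hl : IsLocalMin (fun t : ℝ => regLoss W V B γ (Xs + t • U)) 0 :=
    Filter.Eventually.of_forall fun t => by simpa using hmin (Xs + t • U)
  simpa using hl.hasDerivAt_eq_zero hd

/-- At `X = 0` the attention matrix vanishes, so minimality gives `γ ‖X*‖² ≤ ‖B‖² ≤ n d R²`. The
bound `R / 2` is what keeps `‖X*‖ + ‖X₀ - X*‖` below `2 * R`. -/
theorem frobNorm_minimizer_le {Xs : Matrix (Fin d) (Fin n) ℝ}
    (hmin : ∀ X, regLoss W V B γ Xs ≤ regLoss W V B γ X) : frobNorm Xs ≤ R / 2 := by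
  have h0 := hmin 0
  have hz : ∀ i c, attn W V (0 : Matrix (Fin d) (Fin n) ℝ) i c = 0 := fun i c => by
    simp [attn, value]
  rw [regLoss_eq, regLoss_eq, ← frobNorm_sq] at h0
  simp only [hz, zero_sub, even_two, Even.neg_pow, Matrix.zero_apply, ne_eq, OfNat.ofNat_ne_zero,
    not_false_eq_true, zero_pow, Finset.sum_const_zero, mul_zero, add_zero] at h0
  have h1 : 0 ≤ ∑ i, ∑ c, (attn W V Xs i c - B i c) ^ 2 :=
    Finset.sum_nonneg fun _ _ => Finset.sum_nonneg fun _ _ => sq_nonneg _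
  have h2 : ∑ i, ∑ c, B i c ^ 2 ≤ n * d * R ^ 2 := by
    calc ∑ i, ∑ c, B i c ^ 2 ≤ ∑ _i : Fin n, ∑ _c : Fin d, R ^ 2 :=
          Finset.sum_le_sum fun i _ => Finset.sum_le_sum fun c _ =>
            sq_le_sq' (abs_le.1 (h.abs_B i c)).1 (abs_le.1 (h.abs_B i c)).2
      _ = n * d * R ^ 2 := by simp [mul_assoc]
  have h3 := mul_le_mul_of_nonneg_right h.nd_le (sq_nonneg (frobNorm Xs))
  have h4 : n * d * (100000 * frobNorm Xs ^ 2) ≤ n * d * R ^ 2 := by linarith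
  have h5 := le_of_mul_le_mul_left h4 h.nd_pos
  have h6 := h.one_lt
  exact le_of_sq_le_sq (by nlinarith [sq_nonneg (frobNorm Xs)]) (by linarith)

/-- The mean value theorem for the gradient. -/
theorem abs_lossD_sub_le {Xs E : Matrix (Fin d) (Fin n) ℝ}
    (hE : frobNorm Xs + frobNorm E ≤ 2 * R) (U : Matrix (Fin d) (Fin n) ℝ) :
    |lossD W V B γ (Xs + E) U - lossD W V B γ Xs U - 2 * γ * frobInner U E| ≤
      0.02 * γ * (frobNorm U * frobNorm E) := by
  have hd : ∀ t : ℝ, HasDerivAt (fun t : ℝ => lossD W V B γ (Xs + t • E) U)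
      (lossDD W V B γ (Xs + t • E) U E) t := fun t => hasDerivAt_lossD W V B γ Xs U E t
  -- With the test direction `U` fixed, the scalar mean value theorem suffices; the intermediate
  -- point may depend on `U`.
  obtain ⟨t, ht, he⟩ := exists_hasDerivAt_eq_slope _ _ (zero_lt_one' ℝ)
    (fun t _ => (hd t).continuousAt.continuousWithinAt) fun t _ => hd t
  simp only [one_smul, zero_smul, add_zero, sub_zero, div_one] at he
  rw [← he]
  refine h.abs_lossDD_sub_le ?_ U E
  have h1 := frobNorm_add_le Xs (t • E)
  rw [frobNorm_smul, abs_of_pos ht.1] at h1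
  nlinarith [ht.2, frobNorm_nonneg E]

/-- Pair `H e' = H e - ∇L(X)` with `e'`, where `e` and `e'` are the old and new errors. Both terms
on the right are close to `2γ ⟨e', e⟩`, which cancels and leaves `1.78 * γ * ‖e'‖² ≤ (0.24 + 0.02) *
γ * ‖e'‖ * ‖e‖`. -/
theorem norm_step_le {ε₀ : ℝ} (hε : ε₀ ≤ 1 / 10) {Xs X Y : Matrix (Fin d) (Fin n) ℝ}
    (hmin : ∀ X, regLoss W V B γ Xs ≤ regLoss W V B γ X)
    (hXs : frobNorm Xs + frobNorm (X - Xs) ≤ 2 * R)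
    (hstep : IsApproxNewtonStep ε₀ (regLoss W V B γ) X Y) :
    frobNorm (Y - Xs) ≤ 1 / 2 * frobNorm (X - Xs) := by
  obtain ⟨H, hsymm, hlow, hup, hY⟩ := hstep
  have hγ := h.γ_pos
  have hX : frobNorm X ≤ 2 * R := by
    have := frobNorm_add_le Xs (X - Xs)
    rw [add_sub_cancel] at this
    linarith
  have hnn : ∀ u : Fin d × Fin n → ℝ, 0 ≤ u ⬝ᵥ u := fun u =>
    Finset.sum_nonneg fun _ _ => mul_self_nonneg _
  -- `1.78 ≤ 0.9 * 1.98` and `1.1 * 2.02 ≤ 2.24`.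
  have hq : ∀ u : Fin d × Fin n → ℝ, 1.78 * γ * (u ⬝ᵥ u) ≤ u ⬝ᵥ H.mulVec u ∧
      u ⬝ᵥ H.mulVec u ≤ 2.24 * γ * (u ⬝ᵥ u) := by
    intro u
    have h1 := hlow.dotProduct_mulVec_nonneg u
    have h2 := hup.dotProduct_mulVec_nonneg u
    obtain ⟨h3, h4⟩ := h.quadratic_bounds hX u
    simp only [star_trivial, sub_mulVec, smul_mulVec, dotProduct_sub, dotProduct_smul,
      smul_eq_mul] at h1 h2
    have hu := mul_nonneg hγ.le (hnn u)
    constructor <;> nlinarith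
  have hHpos : H.PosDef := by
    refine Matrix.PosDef.of_dotProduct_mulVec_pos ?_ fun u hu => ?_
    · rw [Matrix.IsHermitian, conjTranspose_eq_transpose_of_trivial]
      exact hsymm
    · rw [star_trivial]
      have hpos : 0 < u ⬝ᵥ u :=
        lt_of_le_of_ne (hnn u) fun h0 => hu (dotProduct_self_eq_zero.1 h0.symm)
      exact lt_of_lt_of_le (by positivity) (hq u).1
  set e := toVec (X - Xs) with he
  set e' := toVec (Y - Xs) with he'
  have hE : toMatrix e = X - Xs := rfl
  have hE' : toMatrix e' = Y - Xs := rfl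
  have heq : H.mulVec e' = H.mulVec e - gradVec (regLoss W V B γ) X := by
    have : e' = e - H⁻¹.mulVec (gradVec (regLoss W V B γ) X) := by
      ext p
      simp only [he, he', toVec, Matrix.sub_apply, hY, Pi.sub_apply, Prod.mk.eta]
      ring
    rw [this, mulVec_sub, mulVec_mulVec, Matrix.mul_nonsing_inv _ hHpos.det_pos.ne'.isUnit,
      one_mulVec]
  have hdot : e' ⬝ᵥ H.mulVec e' = e' ⬝ᵥ H.mulVec e - lossD W V B γ X (Y - Xs) := by
    rw [heq, dotProduct_sub, dotProduct_gradVec, hE']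
  have hmv := h.abs_lossD_sub_le hXs (Y - Xs)
  rw [add_sub_cancel, lossD_eq_zero hmin, sub_zero] at hmv
  -- `0.24` is the larger of `2 - 1.78` and `2.24 - 2`.
  have hpol := abs_dotProduct_mulVec_le (K := H - (2 * γ) • 1) (c := 0.24 * γ)
    (hsymm.sub (by simp [Matrix.IsSymm])) (fun u => by
      simp only [sub_mulVec, smul_mulVec, dotProduct_sub, dotProduct_smul, smul_eq_mul,
        one_mulVec]
      obtain ⟨h1, h2⟩ := hq u
      rw [abs_le]
      constructor <;> linarith [mul_nonneg hγ.le (hnn u)]) e' e (frobNorm_nonneg (Y - Xs))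
    (frobNorm_nonneg (X - Xs)) (dotProduct_self_eq_frobNorm e') (dotProduct_self_eq_frobNorm e)
  simp only [sub_mulVec, smul_mulVec, dotProduct_sub, dotProduct_smul, smul_eq_mul,
    one_mulVec] at hpol
  rw [dotProduct_eq_frobInner e' e, hE, hE'] at hpol
  have hl := (hq e').1
  rw [dotProduct_self_eq_frobNorm, hE', hdot] at hl
  have h1 := (abs_le.1 hpol).2
  have h2 := (abs_le.1 hmv).1
  have hy := frobNorm_nonneg (Y - Xs)
  have hx := frobNorm_nonneg (X - Xs)
  rcases hy.eq_or_lt with h0 | hpos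
  · rw [← h0]
    positivity
  · have h3 : γ * frobNorm (Y - Xs) * (1.78 * frobNorm (Y - Xs)) ≤
        γ * frobNorm (Y - Xs) * (0.26 * frobNorm (X - Xs)) := by nlinarith
    have h4 := le_of_mul_le_mul_left h3 (mul_pos hγ hpos)
    linarith

theorem norm_initial_le {Xs X₀ : Matrix (Fin d) (Fin n) ℝ}
    (hmin : ∀ X, regLoss W V B γ Xs ≤ regLoss W V B γ X) (hX₀ : frobNorm X₀ ≤ R) :
    frobNorm Xs + frobNorm (X₀ - Xs) ≤ 2 * R := by
  have h1 := h.frobNorm_minimizer_le hmin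
  have h2 := frobNorm_add_le X₀ (-Xs)
  rw [← sub_eq_add_neg, frobNorm_neg] at h2
  linarith

/-- The contraction keeps the error at most its initial size, so the ball condition of
`norm_step_le` holds again at the next iterate. -/
theorem norm_iterate_le {ε₀ : ℝ} (hε : ε₀ ≤ 1 / 10)
    {Xs : Matrix (Fin d) (Fin n) ℝ} (hmin : ∀ X, regLoss W V B γ Xs ≤ regLoss W V B γ X)
    {X : ℕ → Matrix (Fin d) (Fin n) ℝ} (hX₀ : frobNorm (X 0) ≤ R) {T : ℕ}
    (hstep : ∀ t < T, IsApproxNewtonStep ε₀ (regLoss W V B γ) (X t) (X (t + 1))) :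
    frobNorm (X T - Xs) ≤ (1 / 2) ^ T * frobNorm (X 0 - Xs) := by
  induction T with
  | zero => simp
  | succ T ih =>
    have h1 := ih fun t ht => hstep t (ht.trans (Nat.lt_succ_self T))
    have h2 : ((1 : ℝ) / 2) ^ T ≤ 1 := pow_le_one₀ (by norm_num) (by norm_num)
    have h3 := mul_le_mul_of_nonneg_right h2 (frobNorm_nonneg (X 0 - Xs))
    have h4 := h.norm_initial_le hmin hX₀
    have h5 := h.norm_step_le hε hmin (X := X T) (by linarith)
      (hstep T (Nat.lt_succ_self T))
    rw [pow_succ]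
    linarith

end Admissible

theorem half_pow_mul_le {x ε : ℝ} {T : ℕ} (hx : 0 ≤ x) (hε : 0 < ε)
    (hT : 2 * Real.log (x / ε) ≤ T) : (1 / 2) ^ T * x ≤ ε := by
  -- For `x = 0` the convention `Real.log 0 = 0` makes the condition on `T` empty.
  rcases hx.eq_or_lt with rfl | hx
  · simpa using hε.le
  have h1 : x / ε ≤ 2 ^ T := by
    rw [← Real.log_le_log_iff (by positivity) (by positivity), Real.log_pow]
    -- The constant `2` works because `2 * log 2 > 1`.
    have := Real.log_two_gt_d9
    have hT0 : (0 : ℝ) ≤ T := Nat.cast_nonneg T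
    nlinarith
  rw [div_le_iff₀ hε] at h1
  rw [one_div, inv_pow, inv_mul_le_iff₀ (by positivity)]
  exact h1

end Newton

/-! ### A program for the gradient and the Hessian of the loss -/

/-- The entry with the row and column `a`, `j` of the coordinate direction with index `p`, `q`. -/
def unitExpr (a j p q : ℕ) : RealExpr := .mul (deltaExpr a p) (deltaExpr j q)

/-- The definitions of the arrays for `scores`, `weight`, `value`, `attn` and their first and second
derivatives in the coordinate directions, up to the gradient in the array `23` and the Hessian in
the array `25`. -/
def derivativeDefs : List ArrayDef :=
  [⟨8, [0, 0], [1, 1], .mul (.mul (cellAt 4 [4, 2]) (cellAt 0 [4, 5])) (cellAt 4 [5, 3])⟩,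
    ⟨9, [0], [0], .exp (cellAt 8 [2, 3])⟩,
    ⟨10, [0, 0], [], .div (.exp (cellAt 8 [2, 3])) (cellAt 9 [2])⟩,
    ⟨11, [0, 1], [1], .mul (cellAt 4 [4, 2]) (cellAt 1 [4, 3])⟩,
    ⟨12, [0, 1], [0], .mul (cellAt 10 [2, 4]) (cellAt 11 [4, 3])⟩,
    ⟨13, [1, 0, 0, 0], [1, 1],
      .add (.mul (.mul (unitExpr 6 4 2 3) (cellAt 0 [6, 7])) (cellAt 4 [7, 5]))
        (.mul (.mul (cellAt 4 [6, 4]) (cellAt 0 [6, 7])) (unitExpr 7 5 2 3))⟩,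
    ⟨14, [1, 0, 1, 0, 0, 0], [1, 1],
      .add (.mul (.mul (unitExpr 8 6 2 3) (cellAt 0 [8, 9])) (unitExpr 9 7 4 5))
        (.mul (.mul (unitExpr 8 6 4 5) (cellAt 0 [8, 9])) (unitExpr 9 7 2 3))⟩,
    ⟨15, [1, 0, 0], [0], .mul (cellAt 10 [4, 5]) (cellAt 13 [2, 3, 4, 5])⟩,
    ⟨16, [1, 0, 0, 0], [],
      .mul (cellAt 10 [4, 5]) (.sub (cellAt 13 [2, 3, 4, 5]) (cellAt 15 [2, 3, 4]))⟩,
    ⟨17, [1, 0, 1, 0, 0], [0],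
      .add (.mul (cellAt 16 [4, 5, 6, 7]) (cellAt 13 [2, 3, 6, 7]))
        (.mul (cellAt 10 [6, 7]) (cellAt 14 [2, 3, 4, 5, 6, 7]))⟩,
    ⟨18, [1, 0, 1, 0, 0, 0], [],
      .add (.mul (cellAt 16 [4, 5, 6, 7])
          (.sub (cellAt 13 [2, 3, 6, 7]) (cellAt 15 [2, 3, 6])))
        (.mul (cellAt 10 [6, 7])
          (.sub (cellAt 14 [2, 3, 4, 5, 6, 7]) (cellAt 17 [2, 3, 4, 5, 6])))⟩,
    ⟨19, [1, 0, 0, 1], [1], .mul (unitExpr 6 4 2 3) (cellAt 1 [6, 5])⟩,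
    ⟨20, [1, 0, 0, 1], [0],
      .add (.mul (cellAt 16 [2, 3, 4, 6]) (cellAt 11 [6, 5]))
        (.mul (cellAt 10 [4, 6]) (cellAt 19 [2, 3, 6, 5]))⟩,
    ⟨21, [1, 0, 1, 0, 0, 1], [0],
      .add (.add (.mul (cellAt 18 [2, 3, 4, 5, 6, 8]) (cellAt 11 [8, 7]))
          (.mul (cellAt 16 [2, 3, 6, 8]) (cellAt 19 [4, 5, 8, 7])))
        (.mul (cellAt 16 [4, 5, 6, 8]) (cellAt 19 [2, 3, 8, 7]))⟩,
    ⟨22, [1, 0], [0, 1],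
      .mul (.mul (.lit 2) (.sub (cellAt 12 [4, 5]) (cellAt 2 [4, 5]))) (cellAt 20 [2, 3, 4, 5])⟩,
    ⟨23, [1, 0], [],
      .add (cellAt 22 [2, 3]) (.mul (.mul (.lit 2) (cellAt 3 [])) (cellAt 4 [2, 3]))⟩,
    ⟨24, [1, 0, 1, 0], [0, 1],
      .mul (.lit 2) (.add (.mul (cellAt 20 [2, 3, 6, 7]) (cellAt 20 [4, 5, 6, 7]))
        (.mul (.sub (cellAt 12 [6, 7]) (cellAt 2 [6, 7])) (cellAt 21 [2, 3, 4, 5, 6, 7])))⟩,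
    ⟨25, [1, 0, 1, 0], [],
      .add (cellAt 24 [2, 3, 4, 5]) (.mul (.mul (.lit 2) (cellAt 3 [])) (unitExpr 4 5 2 3))⟩]

theorem validDefs_derivativeDefs : ValidDefs derivativeDefs := by
  simp [derivativeDefs, ValidDefs, RealExpr.bound, RealExpr.arrays, cellAt, unitExpr, deltaExpr,
    NatExpr.bound]

section Values

variable {n d : ℕ} {W V : Matrix (Fin d) (Fin d) ℝ} {B : Matrix (Fin n) (Fin d) ℝ} {γ : ℝ}
  {X : Matrix (Fin d) (Fin n) ℝ}

theorem eval_unitExpr {s : State} (h : IsIndicator (s.mem 5)) (x y z w : ℕ) :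
    (unitExpr x y z w).eval s =
      (if s.reg x = s.reg z then 1 else 0) * if s.reg y = s.reg w then 1 else 0 := by
  simp only [unitExpr, RealExpr.eval, eval_deltaExpr h]

theorem ite_mul_ite_eq_unit (p : Fin d × Fin n) (a : Fin d) (j : Fin n) :
    ((if (a : ℕ) = p.1 then 1 else 0) * if (j : ℕ) = p.2 then 1 else 0 : ℝ) = unit p a j := by
  simp only [unit_apply, Fin.ext_iff, ite_and]
  split_ifs <;> simp

/-- Each array is identified from its own equation and the arrays before it. An index runs through
the outer registers from `2` on, followed by the summation registers; a coordinate direction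
occupies two of them. -/
theorem derivativeDefs_values {ρ : ℕ → ℕ} {M : ℕ → List ℕ → ℝ} (h0 : ρ 0 = n) (h1 : ρ 1 = d)
    (hM : ∀ o ∈ derivativeDefs, ∀ J, List.Forall₂ (fun j b => j < ρ b) J o.outer →
      M o.target J = nestSum (setRegs ρ 2 J) (2 + o.outer.length) o.inner
        fun σ => o.e.eval ⟨σ, M⟩)
    (hW : ∀ a b : Fin d, M 0 [(a : ℕ), (b : ℕ)] = W a b)
    (hV : ∀ a b : Fin d, M 1 [(a : ℕ), (b : ℕ)] = V a b)
    (hB : ∀ (i : Fin n) (c : Fin d), M 2 [(i : ℕ), (c : ℕ)] = B i c)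
    (hγ : M 3 [] = γ) (hX : ∀ (a : Fin d) (i : Fin n), M 4 [(a : ℕ), (i : ℕ)] = X a i)
    (hδ : IsIndicator (M 5)) :
    (∀ p : Fin d × Fin n, M 23 [(p.1 : ℕ), (p.2 : ℕ)] = gradVec (regLoss W V B γ) X p) ∧
    ∀ p q : Fin d × Fin n, M 25 [(p.1 : ℕ), (p.2 : ℕ), (q.1 : ℕ), (q.2 : ℕ)] =
      hessian (regLoss W V B γ) X p q := by
  have hunit : ∀ (σ : ℕ → ℕ) (x y z w : ℕ), (unitExpr x y z w).eval ⟨σ, M⟩ =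
      (if σ x = σ z then 1 else 0) * if σ y = σ w then 1 else 0 := fun σ x y z w =>
    eval_unitExpr (s := ⟨σ, M⟩) hδ x y z w
  simp only [derivativeDefs, List.forall_mem_cons, List.not_mem_nil, false_implies,
    implies_true, and_true] at hM
  obtain ⟨m8, m9, m10, m11, m12, m13, m14, m15, m16, m17, m18, m19, m20, m21, m22, m23, m24,
    m25⟩ := hM
  have v8 : ∀ i j : Fin n, M 8 [(i : ℕ), (j : ℕ)] = scores W X i j := fun i j => by
    rw [m8 _ (by simp [h0])]
    simp [nestSum, RealExpr.eval, eval_cellAt, setRegs, Function.update, h1, Finset.sum_range,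
      scores, hX, hW]
  have v9 : ∀ i : Fin n, M 9 [(i : ℕ)] = ∑ j, Real.exp (scores W X i j) := fun i => by
    rw [m9 _ (by simp [h0])]
    simp [nestSum, RealExpr.eval, eval_cellAt, setRegs, Function.update, h0, Finset.sum_range,
      v8]
  have v10 : ∀ i j : Fin n, M 10 [(i : ℕ), (j : ℕ)] = weight W X i j := fun i j => by
    rw [m10 _ (by simp [h0])]
    simp [nestSum, RealExpr.eval, eval_cellAt, setRegs, Function.update,
      v8, v9, weight]
  have v11 : ∀ (j : Fin n) (c : Fin d), M 11 [(j : ℕ), (c : ℕ)] = value V X j c := fun j c => by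
    rw [m11 _ (by simp [h0, h1])]
    simp [nestSum, RealExpr.eval, eval_cellAt, setRegs, Function.update, h1, Finset.sum_range,
      hX, hV, value]
  have v12 : ∀ (i : Fin n) (c : Fin d), M 12 [(i : ℕ), (c : ℕ)] = attn W V X i c := fun i c => by
    rw [m12 _ (by simp [h0, h1])]
    simp [nestSum, RealExpr.eval, eval_cellAt, setRegs, Function.update, h0, Finset.sum_range,
      v10, v11, attn]
  have v13 : ∀ (p : Fin d × Fin n) (i j : Fin n),
      M 13 [(p.1 : ℕ), (p.2 : ℕ), (i : ℕ), (j : ℕ)] = scoresD W X (unit p) i j := fun p i j => by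
    rw [m13 _ (by simp [h0, h1])]
    -- The simp lemmas `mul_ite` and `ite_mul` are disabled so that products of two deltas remain
    -- recognizable as entries of `unit p`.
    simp [nestSum, RealExpr.eval, eval_cellAt, setRegs, Function.update, h1, Finset.sum_range,
      hX, hW, hunit, ite_mul_ite_eq_unit, scoresD, -mul_ite, -ite_mul]
  have v14 : ∀ (p q : Fin d × Fin n) (i j : Fin n),
      M 14 [(p.1 : ℕ), (p.2 : ℕ), (q.1 : ℕ), (q.2 : ℕ), (i : ℕ), (j : ℕ)] =
        scoresDD W (unit p) (unit q) i j := fun p q i j => by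
    rw [m14 _ (by simp [h0, h1])]
    simp [nestSum, RealExpr.eval, eval_cellAt, setRegs, Function.update, h1, Finset.sum_range,
      hW, hunit, ite_mul_ite_eq_unit, scoresDD, -mul_ite, -ite_mul]
  have v15 : ∀ (p : Fin d × Fin n) (i : Fin n),
      M 15 [(p.1 : ℕ), (p.2 : ℕ), (i : ℕ)] = meanD W X (unit p) i := fun p i => by
    rw [m15 _ (by simp [h0, h1])]
    simp [nestSum, RealExpr.eval, eval_cellAt, setRegs, Function.update, h0, Finset.sum_range,
      v10, v13, meanD]
  have v16 : ∀ (p : Fin d × Fin n) (i j : Fin n),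
      M 16 [(p.1 : ℕ), (p.2 : ℕ), (i : ℕ), (j : ℕ)] = weightD W X (unit p) i j := fun p i j => by
    rw [m16 _ (by simp [h0, h1])]
    simp [nestSum, RealExpr.eval, eval_cellAt, setRegs, Function.update,
      v10, v13, v15, weightD]
  have v17 : ∀ (p q : Fin d × Fin n) (i : Fin n),
      M 17 [(p.1 : ℕ), (p.2 : ℕ), (q.1 : ℕ), (q.2 : ℕ), (i : ℕ)] =
        meanDD W X (unit p) (unit q) i := fun p q i => by
    rw [m17 _ (by simp [h0, h1])]
    simp [nestSum, RealExpr.eval, eval_cellAt, setRegs, Function.update, h0, Finset.sum_range,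
      v10, v13, v14, v16, meanDD]
  have v18 : ∀ (p q : Fin d × Fin n) (i j : Fin n),
      M 18 [(p.1 : ℕ), (p.2 : ℕ), (q.1 : ℕ), (q.2 : ℕ), (i : ℕ), (j : ℕ)] =
        weightDD W X (unit p) (unit q) i j := fun p q i j => by
    rw [m18 _ (by simp [h0, h1])]
    simp [nestSum, RealExpr.eval, eval_cellAt, setRegs, Function.update,
      v10, v13, v14, v15, v16, v17, weightDD]
  have v19 : ∀ (p : Fin d × Fin n) (j : Fin n) (c : Fin d),
      M 19 [(p.1 : ℕ), (p.2 : ℕ), (j : ℕ), (c : ℕ)] = value V (unit p) j c := fun p j c => by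
    rw [m19 _ (by simp [h0, h1])]
    simp [nestSum, RealExpr.eval, eval_cellAt, setRegs, Function.update, h1, Finset.sum_range,
      hV, hunit, ite_mul_ite_eq_unit, value, -mul_ite, -ite_mul]
  have v20 : ∀ (p : Fin d × Fin n) (i : Fin n) (c : Fin d),
      M 20 [(p.1 : ℕ), (p.2 : ℕ), (i : ℕ), (c : ℕ)] = attnD W V X (unit p) i c := fun p i c => by
    rw [m20 _ (by simp [h0, h1])]
    simp [nestSum, RealExpr.eval, eval_cellAt, setRegs, Function.update, h0, Finset.sum_range,
      v10, v11, v16, v19, attnD]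
  have v21 : ∀ (p q : Fin d × Fin n) (i : Fin n) (c : Fin d),
      M 21 [(p.1 : ℕ), (p.2 : ℕ), (q.1 : ℕ), (q.2 : ℕ), (i : ℕ), (c : ℕ)] =
        attnDD W V X (unit p) (unit q) i c := fun p q i c => by
    rw [m21 _ (by simp [h0, h1])]
    simp [nestSum, RealExpr.eval, eval_cellAt, setRegs, Function.update, h0, Finset.sum_range,
      v11, v16, v18, v19, attnDD]
  have hsum : ∀ (A : Matrix (Fin d) (Fin n) ℝ) (p : Fin d × Fin n),
      ∑ a, ∑ j, A a j * unit p a j = A p.1 p.2 := fun A p => by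
    rw [Finset.sum_eq_single p.1 _ (by simp), Finset.sum_eq_single p.2 _ (by simp)]
    · simp [unit_apply]
    · intro j _ hj
      simp [unit_apply, hj]
    · intro a _ ha
      simp [unit_apply, ha]
  refine ⟨fun p => ?_, fun p q => ?_⟩
  · rw [m23 _ (by simp [h0, h1]), gradVec_apply, lossD, hsum]
    have v22 := m22 [(p.1 : ℕ), (p.2 : ℕ)] (by simp [h0, h1])
    simp [nestSum, RealExpr.eval, eval_cellAt, setRegs, Function.update, h0, h1, Finset.sum_range,
      v12, v20, hB] at v22
    simp [nestSum, RealExpr.eval, eval_cellAt, setRegs, Function.update, hγ, hX, v22]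
  -- The entry `(p, q)` of `hessian` differentiates along `q` before `p`, whereas the arrays list
  -- the directions as `p`, `q`; symmetry reconciles the two.
  · rw [m25 _ (by simp [h0, h1]), hessian_apply, lossDD_comm, lossDD, hsum]
    have v24 := m24 [(p.1 : ℕ), (p.2 : ℕ), (q.1 : ℕ), (q.2 : ℕ)] (by simp [h0, h1])
    simp [nestSum, RealExpr.eval, eval_cellAt, setRegs, Function.update, h0, h1, Finset.sum_range,
      v12, v20, v21, hB] at v24
    simp [nestSum, RealExpr.eval, eval_cellAt, setRegs, Function.update, hγ, v24, hunit,
      ite_mul_ite_eq_unit, fitDD, -mul_ite, -ite_mul]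

end Values

/-! ### The program for a Newton step -/

/-- One Newton step: derivatives, elimination, and the update of the array `4`. -/
def newtonProgram : Program :=
  .seq (.setCell 5 [.lit 0] (.lit 1)) (.seq (defineArrays derivativeDefs)
    (.seq eliminateAll (accum 2 4 [] [1, 0] [] (.mul (.lit (-1)) (cellAt 23 [2, 3])))))

theorem newtonProgram_bounded : newtonProgram.Bounded :=
  ⟨trivial, validDefs_derivativeDefs.bounded, eliminateAll_bounded,
    accum_bounded le_rfl (by decide)⟩

theorem exists_steps_newtonProgram_le : ∃ C k : ℕ, ∀ {n d : ℕ}, 1 ≤ n → 1 ≤ d →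
    ∀ (W V : Matrix (Fin d) (Fin d) ℝ) (B : Matrix (Fin n) (Fin d) ℝ) (γ : ℝ)
      (X : Matrix (Fin d) (Fin n) ℝ), newtonProgram.steps W V B γ X ≤ C * (n * d) ^ k := by
  obtain ⟨C, k, h⟩ := newtonProgram_bounded.exists_steps_le
  -- The product `n * d` is at least `n` and at least `d`, so it serves as the common bound of the
  -- loops.
  exact ⟨C, k, fun hn hd W V B γ X => h _ _ (Nat.mul_pos hn hd) (Nat.le_mul_of_pos_right _ hd)
    (Nat.le_mul_of_pos_left _ hn)⟩

variable {n d : ℕ} {W V : Matrix (Fin d) (Fin d) ℝ} {B : Matrix (Fin n) (Fin d) ℝ} {γ : ℝ}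
  {X : Matrix (Fin d) (Fin n) ℝ}

theorem output_newtonProgram (hH : (hessian (regLoss W V B γ) X).PosDef) (a : Fin d) (j : Fin n) :
    newtonProgram.output W V B γ X a j = X a j -
      ((hessian (regLoss W V B γ) X)⁻¹.mulVec (gradVec (regLoss W V B γ) X)) (a, j) := by
  simp only [Program.output, Matrix.of_apply, newtonProgram, Program.run]
  set s₀ := (inputState W V B γ X).setCell 5 ([NatExpr.lit 0].map
    (NatExpr.eval (inputState W V B γ X))) ((RealExpr.lit 1).eval (inputState W V B γ X)) with hs₀
  have r0 : s₀.reg 0 = n := rfl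
  have r1 : s₀.reg 1 = d := rfl
  have hδ : IsIndicator (s₀.mem 5) := fun k => by
    simp [hs₀, State.setCell, inputState, NatExpr.eval, RealExpr.eval, Function.update_apply]
  have hmem : ∀ b ≠ 5, s₀.mem b = (inputState W V B γ X).mem b := fun b hb => by
    simp [hs₀, State.setCell, Function.update_of_ne hb]
  have h0 := hmem 0 (by decide)
  have h1 := hmem 1 (by decide)
  have h2 := hmem 2 (by decide)
  have h3 := hmem 3 (by decide)
  have h4 := hmem 4 (by decide)
  have hfresh : ∀ b, 5 < b → ∀ J, s₀.mem b J = 0 := fun b hb J => by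
    rw [hmem b (by omega)]
    simp only [inputState]
    split <;> first | omega | rfl
  clear_value s₀
  obtain ⟨d1, d2, d3⟩ := run_defineArrays validDefs_derivativeDefs s₀ fun o ho J =>
    hfresh _ (by
      simp only [derivativeDefs, List.mem_cons, List.not_mem_nil, or_false] at ho
      rcases ho with rfl | rfl | rfl | rfl | rfl | rfl | rfl | rfl | rfl | rfl | rfl | rfl | rfl |
        rfl | rfl | rfl | rfl | rfl <;> decide) J
  generalize ((defineArrays derivativeDefs).run s₀).1 = s₁ at d1 d2 d3 ⊢
  have e5 := d2 5 (by decide)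
  have e4 := d2 4 (by decide)
  obtain ⟨hg, hh⟩ := derivativeDefs_values (W := W) (V := V) (B := B) (γ := γ) (X := X) r0 r1 d3
    (fun a b => by rw [d2 0 (by decide), h0]; simp [inputState, toArray])
    (fun a b => by rw [d2 1 (by decide), h1]; simp [inputState, toArray])
    (fun a b => by rw [d2 2 (by decide), h2]; simp [inputState, toArray])
    (by rw [d2 3 (by decide), h3]; simp [inputState])
    (fun a b => by rw [e4, h4]; simp [inputState, toArray]) (by rw [e5]; exact hδ)
  have hA : arrayMatrix s₁ 25 = hessian (regLoss W V B γ) X := Matrix.ext fun p q => hh p q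
  have hb : arrayVec s₁ 23 = gradVec (regLoss W V B γ) X := funext hg
  obtain ⟨f1, f2, f3, f4⟩ := run_eliminateAll (n := n) (d := d) ((d1 0 (by decide)).trans r0)
    ((d1 1 (by decide)).trans r1) (by rw [e5]; exact hδ)
    (fun J => by rw [d2 26 (by decide)]; exact hfresh 26 (by decide) J)
    (fun J => by rw [d2 27 (by decide)]; exact hfresh 27 (by decide) J) (by rw [hA]; exact hH)
  rw [hA, hb] at f1
  generalize (eliminateAll.run s₁).1 = s₂ at f1 f2 f3 f4 ⊢
  obtain ⟨-, -, -, g4⟩ := run_accum (x := 2) (a := 4) (pre := []) (outer := [1, 0])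
    (inner := []) (e := .mul (.lit (-1)) (cellAt 23 [2, 3])) s₂
    (by decide) (by decide) (by decide) (by decide) (by decide)
  have g := g4 [(a : ℕ), (j : ℕ)] (by simp [f2, f3])
  simp only [List.map_nil, List.nil_append] at g
  rw [g, ← f1, f4, e4, h4]
  simp [nestSum, setRegs, RealExpr.eval, eval_cellAt, Function.update, inputState, toArray,
    arrayVec, sub_eq_add_neg]

/-- The exact Hessian serves as `H`; both required differences equal `ε₀` times it. -/
theorem isApproxNewtonStep_output {ε₀ : ℝ} (hε₀ : 0 < ε₀)
    (hH : (hessian (regLoss W V B γ) X).PosDef) :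
    IsApproxNewtonStep ε₀ (regLoss W V B γ) X (newtonProgram.output W V B γ X) := by
  refine ⟨hessian (regLoss W V B γ) X, hessian_isSymm W V B γ X, ?_, ?_,
    fun a j => output_newtonProgram hH a j⟩
  · convert hH.posSemidef.smul hε₀.le using 1
    module
  · convert hH.posSemidef.smul hε₀.le using 1
    module

theorem iterate_newtonProgram_succ (t : ℕ) :
    newtonProgram.iterate W V B γ X (t + 1) =
      newtonProgram.output W V B γ (newtonProgram.iterate W V B γ X t) :=
  Function.iterate_succ_apply' _ t X

/-- The program solves the system correctly only where the Hessian is positive definite, so the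
iterate must lie in the ball. That follows from the contraction of all earlier steps, hence the
strong induction. -/
theorem Admissible.isApproxNewtonStep_iterate {R ε₀ : ℝ} (h : Admissible W V B R γ)
    (hε₀ : 0 < ε₀) (hε : ε₀ ≤ 1 / 10) {Xs X₀ : Matrix (Fin d) (Fin n) ℝ}
    (hmin : ∀ X, regLoss W V B γ Xs ≤ regLoss W V B γ X) (hX₀ : frobNorm X₀ ≤ R) (t : ℕ) :
    IsApproxNewtonStep ε₀ (regLoss W V B γ) (newtonProgram.iterate W V B γ X₀ t)
      (newtonProgram.iterate W V B γ X₀ (t + 1)) := by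
  induction t using Nat.strong_induction_on with
  | _ t ih =>
    rw [iterate_newtonProgram_succ]
    refine isApproxNewtonStep_output hε₀ (h.hessian_posDef ?_)
    have h1 := h.norm_iterate_le hε hmin (X := newtonProgram.iterate W V B γ X₀) hX₀ ih
    change _ ≤ _ * frobNorm (X₀ - Xs) at h1
    have h2 : ((1 : ℝ) / 2) ^ t ≤ 1 := pow_le_one₀ (by norm_num) (by norm_num)
    have h3 := mul_le_mul_of_nonneg_right h2 (frobNorm_nonneg (X₀ - Xs))
    have h4 := frobNorm_add_le Xs (newtonProgram.iterate W V B γ X₀ t - Xs)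
    rw [add_sub_cancel] at h4
    linarith [h.norm_initial_le hmin hX₀]

end AttentionInversion

theorem theorem10p1 :
    ∃ Cγ CM CT : ℝ, 0 < Cγ ∧ 0 < CM ∧ 0 < CT ∧
    ∀ ε₀ : ℝ, 0 < ε₀ → ε₀ ≤ 1 / 10 →
    ∃ (prog : Program) (C k : ℕ),
    ∀ (n d : ℕ), 1 ≤ n → 1 ≤ d →
    ∀ (R γ : ℝ) (W V : Matrix (Fin d) (Fin d) ℝ) (B : Matrix (Fin n) (Fin d) ℝ),
      1 < R → frobNorm W ≤ R → frobNorm V ≤ R → (∀ i j, |B i j| ≤ R) →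
      Cγ * n * d * R ^ 8 ≤ γ →
      -- the Hessian of the regularized loss is positive definite
      (∀ X, frobNorm X ≤ R → (hessian (regLoss W V B γ) X).PosDef) ∧
      ∀ (Xstar X₀ : Matrix (Fin d) (Fin n) ℝ) (l : ℝ),
        -- `Xstar` is a minimizer, at which the Hessian is at least `l > 0`
        (∀ X, regLoss W V B γ Xstar ≤ regLoss W V B γ X) →
        0 < l →
        (hessian (regLoss W V B γ) Xstar - l • 1).PosSemidef →
        -- good initial point
        frobNorm X₀ ≤ R →
        (CM * n ^ 3 * d ^ 3 * R ^ 10) * frobNorm (X₀ - Xstar) ≤ 0.1 * l →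
        -- convergence of every randomized approximate Newton method
        (∀ ε δ : ℝ, 0 < ε → ε < 0.1 → 0 < δ → δ < 0.1 →
          ∀ T : ℕ, CT * Real.log (frobNorm (X₀ - Xstar) / ε) ≤ T →
          ∀ (Ω : Type*) [MeasurableSpace Ω] (P : MeasureTheory.Measure Ω)
            [MeasureTheory.IsProbabilityMeasure P] (X : ℕ → Ω → Matrix (Fin d) (Fin n) ℝ),
            (∀ ω, X 0 ω = X₀) →
            ENNReal.ofReal (1 - δ) ≤ P {ω | ∀ t < T,
              IsApproxNewtonStep ε₀ (regLoss W V B γ) (X t ω) (X (t + 1) ω)} →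
            ENNReal.ofReal (1 - δ) ≤ P {ω | frobNorm (X T ω - Xstar) ≤ ε}) ∧
        -- an approximate Newton method whose iterations take polynomial time
        (∀ t : ℕ,
          IsApproxNewtonStep ε₀ (regLoss W V B γ)
            (prog.iterate W V B γ X₀ t) (prog.iterate W V B γ X₀ (t + 1)) ∧
          prog.steps W V B γ (prog.iterate W V B γ X₀ t) ≤ C * (n * d) ^ k) ∧
        (∀ ε : ℝ, 0 < ε → ε < 0.1 →
          ∀ T : ℕ, CT * Real.log (frobNorm (X₀ - Xstar) / ε) ≤ T →
          frobNorm (prog.iterate W V B γ X₀ T - Xstar) ≤ ε) := by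
  obtain ⟨C, k, hsteps⟩ := exists_steps_newtonProgram_le
  refine ⟨100000, 1, 2, by norm_num, by norm_num, by norm_num, fun ε₀ hε₀ hε =>
    ⟨newtonProgram, C, k, fun n d hn hd R γ W V B hR hW hV hB hγ => ?_⟩⟩
  have h : Admissible W V B R γ := ⟨hn, hd, hR, hW, hV, hB, hγ⟩
  refine ⟨fun X hX => h.hessian_posDef (hX.trans (by linarith)),
    fun Xstar X₀ l hmin _ _ hX₀ _ => ⟨?_, ?_, ?_⟩⟩
  · intro ε δ hεpos _ _ _ T hT Ω _ P _ X hX hP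
    -- The event that the first `T` steps are approximate Newton steps is contained in the event of
    -- convergence, so monotonicity of the measure is enough and no independence enters.
    refine hP.trans (MeasureTheory.measure_mono fun ω hω => ?_)
    have hstep := h.norm_iterate_le hε hmin (X := fun t => X t ω) (by rw [hX]; exact hX₀) hω
    rw [hX] at hstep
    exact hstep.trans (half_pow_mul_le (frobNorm_nonneg _) hεpos hT)
  · exact fun t => ⟨h.isApproxNewtonStep_iterate hε₀ hε hmin hX₀ t, hsteps hn hd W V B γ _⟩
  · intro ε hεpos _ T hT
    have hstep := h.norm_iterate_le hε hmin (X := newtonProgram.iterate W V B γ X₀) hX₀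
      fun t (_ : t < T) => h.isApproxNewtonStep_iterate hε₀ hε hmin hX₀ t
    exact hstep.trans (half_pow_mul_le (frobNorm_nonneg _) hεpos hT)
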